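/- Let $D>0$, $T>0$, $x_0\in\mathbb R$, let $F\in C^2(\mathbb R)$ have bounded first and second derivatives, let $u_-\neq u_+$ and $\gamma=\frac{F(u_+)-F(u_-)}{u_+-u_-}$, and let $U\in C^2(\mathbb R)$ be a travelling wave profile, i.e. $U_x=\frac1D\big(F(U)-F(u_-)-\gamma(U-u_-)\big)$ and $U(x)\to u_\pm$ as $x\to\pm\infty$. Let $\Phi(x,x')$ be a kernel that is Hilbert--Schmidt from $L^2(\mathbb R)$ to $H^1(\mathbb R)$, i.e. $\Phi,\partial_x\Phi\in L^2(\mathbb R\times\mathbb R)$; write $(\Phi f)(x)=\int\Phi(x,x')f(x')\,dx'$. Let $S(t)$ be the semigroup of the heat equation $u_t=Du_{xx}$, with kernel $\frac{1}{\sqrt{4\pi Dt}}e^{-(x-y)^2/(4Dt)}$ for $t>0$ and $S(0)=\mathrm{Id}$. Let $$\mathcal E^1=\{u:\ u-U\in C([0,T],H^1(\mathbb R))\},\qquad \|f\|_{H^1}^2=\|f\|_{L^2}^2+\|f_x\|_{L^2}^2 .$$ For $h\in L^2([0,T],L^2(\mathbb R))$ write $u=\mathcal H[h]$ if $u\in\mathcal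 E^1$ is the mild solution of $u_t+(F(u))_x=Du_{xx}+\Phi h$, $u(0)=U$, i.e. $$u(t)=S(t)U-\int_0^tS(t-s)\,(F(u(s)))_x\,ds+\int_0^tS(t-s)\,\Phi h(s)\,ds,\qquad t\in[0,T].$$ Define, with $\inf\emptyset=\infty$, $$I(u)=\inf_{h:\,u=\mathcal H[h]}\ \frac12\int_0^T\|h(t,\cdot)\|_{L^2}^2\,dt,\qquad \mathcal J(B)=\inf_{u\in B}I(u)\in[0,\infty]\quad(B\subset\mathcal E^1),$$ and $$A=\{u\in\mathcal E^1:\ u(0,x)=U(x),\ u(T,x)=U(x-\gamma T-x_0)\},$$ $$A_\delta=\{u\in\mathcal E^1:\ u(0,\cdot)=U,\ \|u(T,\cdot)-U(\cdot-\gamma T-x_0)\|_{H^1}\le\delta\}\qquad(\delta>0).$$ Then $\delta\mapsto\mathcal J(A_\delta)$ is nonincreasing on $(0,\infty)$, $\mathcal J(A_\delta)\le\mathcal J(A)$ for every $\delta>0$, and $$\lim_{\delta\to0^+}\mathcal J(A_\delta)=\mathcal J(A)\quad\text{in }[0,\infty].$$ -/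

import Mathlib

open MeasureTheory Filter Topology Set
open scoped ENNReal ContDiff

namespace ShockDisplacement

noncomputable section

/-! ### The Sobolev space `H¹(ℝ)` -/

/-- `g` is the weak derivative of `f` on the real line. -/
def HasWeakDeriv (f g : ℝ → ℝ) : Prop :=
  LocallyIntegrable f volume ∧ LocallyIntegrable g volume ∧
    ∀ φ : ℝ → ℝ, ContDiff ℝ ∞ φ → HasCompactSupport φ →
      ∫ x, f x * deriv φ x = - ∫ x, g x * φ x

open Classical in
/-- A representative of the weak derivative of `f` (unique up to a null set); the value is `0` when
there is no weak derivative. -/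
def weakDeriv (f : ℝ → ℝ) : ℝ → ℝ :=
  if h : ∃ g, HasWeakDeriv f g then h.choose else 0

/-- Membership in `H¹(ℝ)`: `f` and its weak derivative are square integrable. -/
def MemH1 (f : ℝ → ℝ) : Prop :=
  MemLp f 2 volume ∧ ∃ g, HasWeakDeriv f g ∧ MemLp g 2 volume

/-- The `H¹(ℝ)` norm `(‖f‖² + ‖f'‖²)^{1/2}` (with `L²` norms on the right), with value `∞` when `f`
has no weak derivative. The infimum is over the (almost everywhere equal) weak derivatives of `f`. -/
def eH1norm (f : ℝ → ℝ) : ℝ≥0∞ :=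
  ⨅ (g : ℝ → ℝ) (_ : HasWeakDeriv f g),
    (eLpNorm f 2 volume ^ 2 + eLpNorm g 2 volume ^ 2) ^ (1 / 2 : ℝ)

/-! ### The travelling wave -/

/-- The Rankine-Hugoniot speed of a wave joining `uL` (at `-∞`) to `uR` (at `+∞`). -/
def waveSpeed (F : ℝ → ℝ) (uL uR : ℝ) : ℝ := (F uR - F uL) / (uR - uL)

/-- `U` is a viscous travelling wave profile for `u_t + F(u)_x = D u_xx` joining `uL` to `uR`. -/
structure IsWaveProfile (F : ℝ → ℝ) (D uL uR : ℝ) (U : ℝ → ℝ) : Prop where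
  contDiff : ContDiff ℝ 2 U
  ode : ∀ x, deriv U x = (1 / D) * (F (U x) - F uL - waveSpeed F uL uR * (U x - uL))
  tendsto_atBot : Tendsto U atBot (𝓝 uL)
  tendsto_atTop : Tendsto U atTop (𝓝 uR)

/-! ### Paths, noise kernel and the controlled equation -/

/-- The path space `ℰ¹`: `u - U ∈ C([0,T], H¹(ℝ))`. Only the times in `[0,T]` matter, and each
`u t` matters only up to a null set. -/
def pathSpace (T : ℝ) (U : ℝ → ℝ) : Set (ℝ → ℝ → ℝ) :=
  {u | (∀ t ∈ Icc 0 T, MemH1 (fun x => u t x - U x)) ∧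
    ∀ t ∈ Icc 0 T,
      Tendsto (fun s => eH1norm (fun x => u s x - u t x)) (𝓝[Icc 0 T] t) (𝓝 0)}

/-- The kernel `Φ` is Hilbert-Schmidt from `L²(ℝ)` to `H¹(ℝ)`: the kernel and its weak derivative in
the first variable belong to `L²(ℝ × ℝ)`. -/
def IsHilbertSchmidtH1 (Φ : ℝ → ℝ → ℝ) : Prop :=
  MemLp (Function.uncurry Φ) 2 (volume.prod volume) ∧
    ∃ Ψ : ℝ → ℝ → ℝ, MemLp (Function.uncurry Ψ) 2 (volume.prod volume) ∧
      ∀ᵐ x', HasWeakDeriv (fun x => Φ x x') (fun x => Ψ x x')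

/-- The integral operator with kernel `Φ`. -/
def kernelOp (Φ : ℝ → ℝ → ℝ) (f : ℝ → ℝ) (x : ℝ) : ℝ := ∫ x', Φ x x' * f x'

/-- The heat semigroup of `u_t = D u_xx`. -/
def heat (D t : ℝ) (f : ℝ → ℝ) (x : ℝ) : ℝ :=
  if t = 0 then f x
  else ∫ y, (1 / Real.sqrt (4 * Real.pi * D * t)) *
    Real.exp (-(x - y) ^ 2 / (4 * D * t)) * f y

/-- `h ∈ L²([0,T], L²(ℝ))`. -/
def IsControl (T : ℝ) (h : ℝ → ℝ → ℝ) : Prop :=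
  MemLp (Function.uncurry h) 2 ((volume.restrict (Icc 0 T)).prod volume)

/-- `u = ℋ[h]`: the path `u` lies in `ℰ¹` and is the mild solution of
`u_t + F(u)_x = D u_xx + Φ h`, `u(0) = U`, on `[0,T]`. -/
def IsMildSolution (F : ℝ → ℝ) (D T : ℝ) (U : ℝ → ℝ) (Φ : ℝ → ℝ → ℝ)
    (h u : ℝ → ℝ → ℝ) : Prop :=
  u ∈ pathSpace T U ∧
    ∀ t ∈ Icc 0 T, ∀ᵐ x,
      u t x = heat D t U x
        - (∫ s in (0 : ℝ)..t, heat D (t - s) (weakDeriv (fun y => F (u s y))) x)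
        + ∫ s in (0 : ℝ)..t, heat D (t - s) (kernelOp Φ (h s)) x

/-! ### The rate function and the rare events -/

/-- The cost `½ ∫₀ᵀ ‖h(t)‖² dt` of a control. -/
def controlCost (T : ℝ) (h : ℝ → ℝ → ℝ) : ℝ≥0∞ :=
  (1 / 2) * ∫⁻ t in Icc 0 T, eLpNorm (h t) 2 volume ^ 2

/-- The rate function `I(u)`, the infimum of the cost over the controls `h` with `u = ℋ[h]`
(`∞` if there is none). -/
def rate (F : ℝ → ℝ) (D T : ℝ) (U : ℝ → ℝ) (Φ : ℝ → ℝ → ℝ) (u : ℝ → ℝ → ℝ) : ℝ≥0∞ :=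
  ⨅ (h : ℝ → ℝ → ℝ) (_ : IsControl T h ∧ IsMildSolution F D T U Φ h u), controlCost T h

/-- `𝒥(A) = inf_{u ∈ A} I(u)`. -/
def rateInf (F : ℝ → ℝ) (D T : ℝ) (U : ℝ → ℝ) (Φ : ℝ → ℝ → ℝ) (A : Set (ℝ → ℝ → ℝ)) : ℝ≥0∞ :=
  ⨅ u ∈ A, rate F D T U Φ u

/-- The displacement event: `u(0,x) = U(x)` and `u(T,x) = U(x - γ T - x₀)`. -/
def displacementEvent (γ T x₀ : ℝ) (U : ℝ → ℝ) : Set (ℝ → ℝ → ℝ) :=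
  {u | u ∈ pathSpace T U ∧ u 0 =ᵐ[volume] U ∧
    u T =ᵐ[volume] fun x => U (x - γ * T - x₀)}

/-- The enlarged event: `u(0,·) = U` and `‖u(T,·) - U(· - γ T - x₀)‖ ≤ δ` in the `H¹` norm. -/
def displacementEventNhd (γ T x₀ : ℝ) (U : ℝ → ℝ) (δ : ℝ) : Set (ℝ → ℝ → ℝ) :=
  {u | u ∈ pathSpace T U ∧ u 0 =ᵐ[volume] U ∧
    eH1norm (fun x => u T x - U (x - γ * T - x₀)) ≤ ENNReal.ofReal δ}

end

end ShockDisplacement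

namespace ShockDisplacement

noncomputable section

/-! ### Weak derivatives on the line -/

/-! Monotonicity and the bound by the cost of the exact event are inclusions of events. The limit is
a lower semicontinuity statement, carried by `rateInf_displacementEvent_le`: if every enlarged event
is reachable at cost below a finite `R`, then the exact event is reachable at cost at most `R`.

Take controls of cost below `R` for `δ = 1/(n+1)`. They are bounded in `L²([0,T] × ℝ)`, hence
converge weakly along an ultrafilter to a control `k₀` that obeys the same norm bound. With `u = U +
v` the mild equation becomes an identity in `H¹`: `v(t)` plus the Duhamel integral of `∂ₓF(U + v)`
minus a noise term equals `S(t)U - U`. The noise term pairs the scalar control with the `H¹`-valued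
kernel `S(t-s)Φ(·,x')`. As a curve in `L²([0,T] × ℝ; H¹)` this kernel is continuous in `t`
(`continuous_noiseCurve`), so its image over `[0,T]` is compact, and weak convergence of the
controls makes the noise terms converge in `H¹` uniformly in time (`eventually_pairing_lt`).

The nonlinearity maps `H¹` to `L²` and is locally Lipschitz (`FluxData.nonlin_sub_le`), while the
heat flow returns to `H¹` at the price of `(t-s)^{-1/2}`. A Gronwall inequality with this singular
kernel (`singular_gronwall`) converts uniform convergence of the noise terms into a uniform Cauchy
property of the paths. Their limit solves the equation with control `k₀` and has the exact terminal
value (`exists_limit_solution`). No existence theory for the controlled equation is needed, since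
the limit path is built from solutions that already exist; nor must `S(t)U - U` be studied
separately, since all solutions share it. -/

lemma integrable_mul_of_hasCompactSupport {f φ : ℝ → ℝ} (hf : LocallyIntegrable f volume)
    (hφ : Continuous φ) (hc : HasCompactSupport φ) : Integrable (fun x => f x * φ x) := by
  have := hf.integrable_smul_left_of_hasCompactSupport hφ hc
  simpa [mul_comm] using this

lemma HasWeakDeriv.ae_unique {f g g' : ℝ → ℝ} (h : HasWeakDeriv f g) (h' : HasWeakDeriv f g') :
    g =ᵐ[volume] g' := by
  refine ae_eq_of_integral_contDiff_smul_eq h.2.1 h'.2.1 fun φ hφ hc => ?_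
  have h1 := h.2.2 φ hφ hc
  have h2 := h'.2.2 φ hφ hc
  simp only [smul_eq_mul, mul_comm (φ _)]
  linarith

lemma HasWeakDeriv.congr {f f' g g' : ℝ → ℝ} (h : HasWeakDeriv f g) (hf : f =ᵐ[volume] f')
    (hg : g =ᵐ[volume] g') : HasWeakDeriv f' g' := by
  refine ⟨h.1.congr hf, h.2.1.congr hg, fun φ hφ hc => ?_⟩
  have h1 : ∫ x, f x * deriv φ x = ∫ x, f' x * deriv φ x :=
    integral_congr_ae (hf.mul (EventuallyEq.refl _ (deriv φ)))
  have h2 : ∫ x, g x * φ x = ∫ x, g' x * φ x :=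
    integral_congr_ae (hg.mul (EventuallyEq.refl _ φ))
  rw [← h1, ← h2]
  exact h.2.2 φ hφ hc

lemma continuous_deriv_of_smooth {φ : ℝ → ℝ} (hφ : ContDiff ℝ ∞ φ) : Continuous (deriv φ) :=
  hφ.continuous_deriv (by simp)

lemma HasWeakDeriv.add {f₁ f₂ g₁ g₂ : ℝ → ℝ} (h₁ : HasWeakDeriv f₁ g₁) (h₂ : HasWeakDeriv f₂ g₂) :
    HasWeakDeriv (fun x => f₁ x + f₂ x) (fun x => g₁ x + g₂ x) := by
  refine ⟨h₁.1.add h₂.1, h₁.2.1.add h₂.2.1, fun φ hφ hc => ?_⟩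
  have i1 := integrable_mul_of_hasCompactSupport h₁.1 (continuous_deriv_of_smooth hφ) hc.deriv
  have i2 := integrable_mul_of_hasCompactSupport h₂.1 (continuous_deriv_of_smooth hφ) hc.deriv
  have i3 := integrable_mul_of_hasCompactSupport h₁.2.1 hφ.continuous hc
  have i4 := integrable_mul_of_hasCompactSupport h₂.2.1 hφ.continuous hc
  simp only [add_mul]
  rw [integral_add i1 i2, integral_add i3 i4, h₁.2.2 φ hφ hc, h₂.2.2 φ hφ hc]
  ring

lemma HasWeakDeriv.const_mul {f g : ℝ → ℝ} (h : HasWeakDeriv f g) (c : ℝ) :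
    HasWeakDeriv (fun x => c * f x) (fun x => c * g x) := by
  refine ⟨h.1.smul c, h.2.1.smul c, fun φ hφ hc => ?_⟩
  simp only [mul_assoc]
  rw [integral_const_mul, integral_const_mul, h.2.2 φ hφ hc]
  ring

lemma HasWeakDeriv.sub {f₁ f₂ g₁ g₂ : ℝ → ℝ} (h₁ : HasWeakDeriv f₁ g₁) (h₂ : HasWeakDeriv f₂ g₂) :
    HasWeakDeriv (fun x => f₁ x - f₂ x) (fun x => g₁ x - g₂ x) := by
  refine (h₁.add (h₂.const_mul (-1))).congr (ae_of_all _ fun x => ?_) (ae_of_all _ fun x => ?_) <;>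
  ring

lemma intervalIntegrable_of_locallyIntegrable {g : ℝ → ℝ} (hg : LocallyIntegrable g volume)
    (a b : ℝ) : IntervalIntegrable g volume a b :=
  intervalIntegrable_iff.mpr
    ((hg.integrableOn_isCompact isCompact_uIcc).mono_set uIoc_subset_uIcc)

/-- A continuous function with a locally integrable a.e. derivative that is absolutely continuous
on every bounded interval has that derivative as weak derivative. -/
lemma hasWeakDeriv_of_absolutelyContinuous {f g : ℝ → ℝ} (hg : LocallyIntegrable g volume)
    (hf : ∀ R : ℝ, 0 < R → AbsolutelyContinuousOnInterval f (-R) R)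
    (hd : ∀ᵐ x, HasDerivAt f (g x) x) : HasWeakDeriv f g := by
  have hcont : Continuous f := by
    refine continuous_iff_continuousAt.2 fun x => ?_
    have h1 := (hf (|x| + 1) (by positivity)).continuousOn
    refine h1.continuousAt ?_
    rw [uIcc_of_le (by linarith [abs_nonneg x])]
    exact Icc_mem_nhds (by linarith [neg_abs_le x]) (by linarith [le_abs_self x])
  refine ⟨hcont.locallyIntegrable, hg, fun φ hφ hc => ?_⟩
  obtain ⟨R, hR, hsub⟩ : ∃ R : ℝ, 0 < R ∧ tsupport φ ⊆ Ioo (-R) R := by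
    obtain ⟨R, hR⟩ := hc.isCompact.isBounded.subset_ball_lt 0 (0 : ℝ)
    exact ⟨R, hR.1, by simpa [Real.ball_eq_Ioo] using hR.2⟩
  have key : ∀ ψ : ℝ → ℝ, tsupport ψ ⊆ tsupport φ →
      ∫ x, ψ x = ∫ x in (-R)..R, ψ x := fun ψ hψ =>
    (intervalIntegral.integral_eq_integral_of_support_subset
      ((subset_tsupport ψ).trans (hψ.trans (hsub.trans Ioo_subset_Ioc_self)))).symm
  have hφac : AbsolutelyContinuousOnInterval φ (-R) R :=
    (hφ.of_le (by simp)).contDiffOn.absolutelyContinuousOnInterval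
  have e0 : φ R = 0 := image_eq_zero_of_notMem_tsupport fun h => (hsub h).2.ne rfl
  have e1 : φ (-R) = 0 := image_eq_zero_of_notMem_tsupport fun h => (hsub h).1.ne rfl
  rw [key (fun x => f x * deriv φ x) ((tsupport_mul_subset_right).trans (tsupport_deriv_subset)),
    key (fun x => g x * φ x) tsupport_mul_subset_right,
    (hf R hR).integral_mul_deriv_eq_deriv_mul hφac, e0, e1]
  have : ∫ x in (-R)..R, deriv f x * φ x = ∫ x in (-R)..R, g x * φ x := by
    refine intervalIntegral.integral_congr_ae ?_
    filter_upwards [hd] with x hx _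
    rw [hx.deriv]
  rw [this]; ring

lemma absolutelyContinuous_primitive {g : ℝ → ℝ} (hg : LocallyIntegrable g volume) (c : ℝ)
    (R : ℝ) (hR : 0 < R) :
    AbsolutelyContinuousOnInterval (fun x => c + ∫ y in (0 : ℝ)..x, g y) (-R) R := by
  have h1 := (intervalIntegrable_of_locallyIntegrable hg (-R)
    R).absolutelyContinuousOnInterval_intervalIntegral (c := 0)
    (by rw [uIcc_of_le (by linarith)]; constructor <;> linarith)
  have h2 : AbsolutelyContinuousOnInterval (fun _ : ℝ => c) (-R) R :=
    (LipschitzWith.const c).lipschitzOnWith.absolutelyContinuousOnInterval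
  exact h2.add h1

lemma ae_hasDerivAt_primitive {g : ℝ → ℝ} (hg : LocallyIntegrable g volume) (c : ℝ) :
    ∀ᵐ x, HasDerivAt (fun x => c + ∫ y in (0 : ℝ)..x, g y) (g x) x := by
  filter_upwards [LocallyIntegrable.ae_hasDerivAt_integral hg] with x hx
  exact (hx 0).const_add c

lemma hasWeakDeriv_primitive {g : ℝ → ℝ} (hg : LocallyIntegrable g volume) (c : ℝ) :
    HasWeakDeriv (fun x => c + ∫ y in (0 : ℝ)..x, g y) g :=
  hasWeakDeriv_of_absolutelyContinuous hg (absolutelyContinuous_primitive hg c)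
    (ae_hasDerivAt_primitive hg c)

/-- The primitive based at `-R` vanishes to the left of the support and equals the total integral to
the right of it, so zero mean is exactly what gives compact support. -/
lemma exists_smooth_primitive {φ : ℝ → ℝ} (hφ : ContDiff ℝ ∞ φ) (hc : HasCompactSupport φ)
    (h0 : ∫ x, φ x = 0) : ∃ ψ : ℝ → ℝ, ContDiff ℝ ∞ ψ ∧ HasCompactSupport ψ ∧ deriv ψ = φ := by
  obtain ⟨R, hR, hsub⟩ : ∃ R : ℝ, 0 < R ∧ tsupport φ ⊆ Ioo (-R) R := by
    obtain ⟨R, hR⟩ := hc.isCompact.isBounded.subset_ball_lt 0 (0 : ℝ)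
    exact ⟨R, hR.1, by simpa [Real.ball_eq_Ioo] using hR.2⟩
  have hz : ∀ x, x ∉ Ioo (-R) R → φ x = 0 := fun x hx =>
    image_eq_zero_of_notMem_tsupport fun h => hx (hsub h)
  have hd : ∀ x, HasDerivAt (fun x => ∫ y in (-R)..x, φ y) (φ x) x := fun x =>
    hφ.continuous.integral_hasStrictDerivAt (-R) x |>.hasDerivAt
  have hder : deriv (fun x => ∫ y in (-R)..x, φ y) = φ := funext fun x => (hd x).deriv
  refine ⟨fun x => ∫ y in (-R)..x, φ y, ?_, ?_, hder⟩
  · rw [contDiff_infty_iff_deriv, hder]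
    exact ⟨fun x => (hd x).differentiableAt, hφ⟩
  · refine HasCompactSupport.intro (isCompact_Icc (a := -R) (b := R)) fun x hx => ?_
    have hx' : x < -R ∨ R < x := by
      by_contra! h; exact hx ⟨h.1, h.2⟩
    rcases hx' with hx' | hx'
    · refine intervalIntegral.integral_zero_ae (ae_of_all _ fun y hy => hz y ?_)
      rw [uIoc_of_ge hx'.le] at hy
      exact fun h => by linarith [hy.2, h.1]
    · rw [intervalIntegral.integral_eq_integral_of_support_subset, h0]
      intro y hy
      have : y ∈ Ioo (-R) R := by by_contra h; exact hy (hz y h)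
      exact ⟨this.1, by linarith [this.2]⟩

/-- The du Bois-Reymond lemma: a function with vanishing weak derivative is constant. -/
lemma HasWeakDeriv.ae_const {f : ℝ → ℝ} (h : HasWeakDeriv f 0) :
    ∃ c : ℝ, f =ᵐ[volume] fun _ => c := by
  let B : ContDiffBump (0 : ℝ) := ⟨1, 2, one_pos, one_lt_two⟩
  let ρ : ℝ → ℝ := B.normed volume
  have hρ : ContDiff ℝ ∞ ρ := B.contDiff_normed
  have hρc : HasCompactSupport ρ := B.hasCompactSupport_normed
  have hρ1 : ∫ x, ρ x = 1 := B.integral_normed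
  -- The constant is the `ρ`-average of `f`: subtracting `m * ρ` from a test function of mass `m`
  -- leaves mean zero, hence the derivative of a test function, against which `f` integrates to
  -- zero.
  refine ⟨∫ x, f x * ρ x, ae_eq_of_integral_contDiff_smul_eq h.1
    (locallyIntegrable_const _) fun φ hφ hc => ?_⟩
  set m := ∫ x, φ x with hm
  have hφi : Integrable φ := hφ.continuous.integrable_of_hasCompactSupport hc
  have hρi : Integrable ρ := hρ.continuous.integrable_of_hasCompactSupport hρc
  obtain ⟨ψ, hψ, hψc, hψd⟩ := exists_smooth_primitive (φ := fun x => φ x - m * ρ x)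
    (hφ.sub (contDiff_const.mul hρ)) (hc.sub (hρc.mul_left)) (by
      rw [integral_sub hφi (hρi.const_mul m), integral_const_mul, hρ1, ← hm]; ring)
  have h1 := h.2.2 ψ hψ hψc
  simp only [hψd, Pi.zero_apply, zero_mul, integral_zero, neg_zero, mul_sub] at h1
  have i1 := integrable_mul_of_hasCompactSupport h.1 hφ.continuous hc
  have i2 := integrable_mul_of_hasCompactSupport h.1 hρ.continuous hρc
  have e : ∀ x, f x * (m * ρ x) = m * (f x * ρ x) := fun x => by ring
  simp only [e] at h1
  rw [integral_sub i1 (i2.const_mul m), integral_const_mul] at h1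
  simp only [smul_eq_mul, integral_mul_const, mul_comm (φ _) (f _)]
  linarith

lemma HasWeakDeriv.exists_primitive {f g : ℝ → ℝ} (h : HasWeakDeriv f g) :
    ∃ c : ℝ, f =ᵐ[volume] fun x => c + ∫ y in (0 : ℝ)..x, g y := by
  obtain ⟨c, hc⟩ := ((h.sub (hasWeakDeriv_primitive h.2.1 0)).congr (EventuallyEq.refl _ _)
    (g' := 0) (ae_of_all _ fun x => by simp)).ae_const
  refine ⟨c, ?_⟩
  filter_upwards [hc] with x hx
  linarith

lemma continuous_primitive {g : ℝ → ℝ} (hg : LocallyIntegrable g volume) (c : ℝ) :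
    Continuous (fun x => c + ∫ y in (0 : ℝ)..x, g y) :=
  continuous_const.add (intervalIntegral.continuous_primitive
    (intervalIntegrable_of_locallyIntegrable hg) 0)

lemma AbsolutelyContinuousOnInterval.lipschitz_comp {f F : ℝ → ℝ} {a b : ℝ} {K : NNReal}
    (hF : LipschitzWith K F) (hf : AbsolutelyContinuousOnInterval f a b) :
    AbsolutelyContinuousOnInterval (fun x => F (f x)) a b := by
  rw [absolutelyContinuousOnInterval_iff] at hf ⊢
  intro ε hε
  obtain ⟨δ, hδ, h⟩ := hf (ε / (K + 1)) (by positivity)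
  refine ⟨δ, hδ, fun E hE hs => ?_⟩
  have h1 := h E hE hs
  calc _ ≤ ∑ i ∈ Finset.range E.1, (K + 1) * dist (f (E.2 i).1) (f (E.2 i).2) :=
        Finset.sum_le_sum fun i _ => (hF.dist_le_mul _ _).trans
          (by nlinarith [dist_nonneg (x := f (E.2 i).1) (y := f (E.2 i).2)])
    _ < ε := by
        rw [← Finset.mul_sum]
        rwa [lt_div_iff₀ (by positivity), mul_comm] at h1

/-- The chain rule for weak derivatives. -/
lemma HasWeakDeriv.comp {f g F : ℝ → ℝ} {C : ℝ} (h : HasWeakDeriv f g) (hF : ContDiff ℝ 1 F)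
    (hC : ∀ v, |deriv F v| ≤ C) :
    HasWeakDeriv (fun x => F (f x)) (fun x => deriv F (f x) * g x) := by
  -- The absolutely continuous representative has the classical derivative `g x` at almost every
  -- point, so the ordinary chain rule applies there.
  obtain ⟨c, hc⟩ := h.exists_primitive
  set p : ℝ → ℝ := fun x => c + ∫ y in (0 : ℝ)..x, g y with hp
  have hC0 : 0 ≤ C := (abs_nonneg _).trans (hC 0)
  have hL : LipschitzWith ⟨C, hC0⟩ F := lipschitzWith_of_nnnorm_deriv_le
    (hF.differentiable one_ne_zero) fun x => hC x
  have hcp : Continuous p := continuous_primitive h.2.1 c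
  have hdc : Continuous (deriv F) := hF.continuous_deriv le_rfl
  have key : HasWeakDeriv (fun x => F (p x)) (fun x => deriv F (p x) * g x) := by
    refine hasWeakDeriv_of_absolutelyContinuous ?_ (fun R hR =>
      AbsolutelyContinuousOnInterval.lipschitz_comp hL
        (absolutelyContinuous_primitive h.2.1 c R hR)) ?_
    · have := h.2.1.continuous_mul (hdc.comp hcp)
      exact this
    · filter_upwards [ae_hasDerivAt_primitive h.2.1 c] with x hx
      exact ((hF.differentiable one_ne_zero _).hasDerivAt).comp x hx
  refine key.congr ?_ ?_
  · filter_upwards [hc] with x hx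
    rw [hx]
  · filter_upwards [hc] with x hx
    rw [hx]

lemma hasWeakDeriv_of_contDiff {f : ℝ → ℝ} (hf : ContDiff ℝ 1 f) : HasWeakDeriv f (deriv f) := by
  refine hasWeakDeriv_of_absolutelyContinuous (hf.continuous_deriv le_rfl).locallyIntegrable
    (fun R _ => hf.contDiffOn.absolutelyContinuousOnInterval)
    (ae_of_all _ fun x => (hf.differentiable one_ne_zero x).hasDerivAt)

lemma HasWeakDeriv.weakDeriv_ae_eq {f g : ℝ → ℝ} (h : HasWeakDeriv f g) :
    weakDeriv f =ᵐ[volume] g := by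
  have hex : ∃ g, HasWeakDeriv f g := ⟨g, h⟩
  rw [weakDeriv, dif_pos hex]
  exact hex.choose_spec.ae_unique h

/-! ### `H¹(ℝ)` as a Banach space -/

/-- The space `L²(ℝ)`. -/
abbrev L2R : Type := Lp ℝ 2 (volume : Measure ℝ)

lemma L2R.locallyIntegrable (f : L2R) : LocallyIntegrable f volume :=
  (Lp.memLp f).locallyIntegrable (by norm_num)

/-- The graph of the weak derivative in `L²(ℝ) × L²(ℝ)`. -/
def H1sub : Submodule ℝ (L2R × L2R) where
  carrier := {y | HasWeakDeriv y.1 y.2}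
  add_mem' := fun {a b} ha hb => (HasWeakDeriv.add ha hb).congr
    (Lp.coeFn_add a.1 b.1).symm (Lp.coeFn_add a.2 b.2).symm
  zero_mem' := by
    have h : HasWeakDeriv (fun _ => 0) (fun _ => 0) :=
      ⟨locallyIntegrable_const 0, locallyIntegrable_const 0, fun φ _ _ => by simp⟩
    exact h.congr (Lp.coeFn_zero ℝ 2 volume).symm (Lp.coeFn_zero ℝ 2 volume).symm
  smul_mem' := fun c a ha => (HasWeakDeriv.const_mul ha c).congr
    (Lp.coeFn_smul c a.1).symm (Lp.coeFn_smul c a.2).symm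

/-- `H¹(ℝ)`, as pairs of a square integrable function and its weak derivative. -/
abbrev H1 : Type := H1sub

lemma H1.hasWeakDeriv (y : H1) : HasWeakDeriv y.1.1 y.1.2 := y.2

lemma L2R.integral_mul_eq_inner (f : L2R) {ψ : ℝ → ℝ} (hψ : MemLp ψ 2 volume) :
    ∫ x, f x * ψ x = inner ℝ (hψ.toLp ψ) f := by
  rw [L2.inner_def]
  refine integral_congr_ae ?_
  filter_upwards [hψ.coeFn_toLp] with x hx
  simp [hx]

/-- Each test identity equates two continuous functionals, inner products with fixed `L²` functions,
so it cuts out a closed set. This is the source of completeness of `H1`. -/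
lemma isClosed_H1sub : IsClosed (H1sub : Set (L2R × L2R)) := by
  have h : (H1sub : Set (L2R × L2R)) = ⋂ (φ : ℝ → ℝ) (_ : ContDiff ℝ ∞ φ)
      (_ : HasCompactSupport φ), {y | ∫ x, y.1 x * deriv φ x = - ∫ x, y.2 x * φ x} := by
    ext y
    simp only [SetLike.mem_coe, mem_iInter, mem_ofPred_eq]
    exact ⟨fun h => h.2.2, fun h => ⟨y.1.locallyIntegrable, y.2.locallyIntegrable, h⟩⟩
  rw [h]
  refine isClosed_iInter fun φ => isClosed_iInter fun hφ => isClosed_iInter fun hc => ?_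
  have m1 : MemLp φ 2 volume := hφ.continuous.memLp_of_hasCompactSupport hc
  have m2 : MemLp (deriv φ) 2 volume :=
    (continuous_deriv_of_smooth hφ).memLp_of_hasCompactSupport hc.deriv
  simp only [fun y : L2R × L2R => y.1.integral_mul_eq_inner m2,
    fun y : L2R × L2R => y.2.integral_mul_eq_inner m1]
  exact isClosed_eq (by fun_prop) (by fun_prop)

instance : CompleteSpace H1 := isClosed_H1sub.completeSpace_coe

/-- The element of `H¹(ℝ)` given by a function and its weak derivative. -/
def H1.mk (f g : ℝ → ℝ) (hf : MemLp f 2 volume) (hg : MemLp g 2 volume)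
    (h : HasWeakDeriv f g) : H1 :=
  ⟨(hf.toLp f, hg.toLp g), h.congr hf.coeFn_toLp.symm hg.coeFn_toLp.symm⟩

lemma H1.norm_eq (y : H1) : ‖y‖ = max ‖y.1.1‖ ‖y.1.2‖ := rfl

lemma H1.norm_fst_le (y : H1) : ‖y.1.1‖ ≤ ‖y‖ := le_max_left _ _

lemma H1.norm_snd_le (y : H1) : ‖y.1.2‖ ≤ ‖y‖ := le_max_right _ _

/-- Weak derivatives are unique, so identities in `H1`, including those between solution defects,
need only be checked almost everywhere on the functions themselves. -/
lemma H1.ext_fst {y z : H1} (h : y.1.1 = z.1.1) : y = z := by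
  refine Subtype.ext (Prod.ext h ?_)
  refine Lp.ext ?_
  have hz := z.hasWeakDeriv
  rw [← h] at hz
  exact y.hasWeakDeriv.ae_unique hz

/-! ### Continuous representatives and point evaluation -/

lemma setIntegral_unit_le_norm (f : L2R) (x : ℝ) : ∫ y in Ioc x (x + 1), ‖f y‖ ≤ ‖f‖ := by
  have : IsProbabilityMeasure (volume.restrict (Ioc x (x + 1))) :=
    ⟨by simp⟩
  have h1 : eLpNorm f 1 (volume.restrict (Ioc x (x + 1))) ≤ eLpNorm f 2 volume :=
    (eLpNorm_le_eLpNorm_of_exponent_le (by norm_num) (Lp.aestronglyMeasurable f).restrict).trans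
      (eLpNorm_restrict_le _ _ _ _)
  rw [integral_norm_eq_lintegral_enorm (Lp.aestronglyMeasurable f).restrict,
    ← eLpNorm_one_eq_lintegral_enorm, Lp.norm_def]
  exact ENNReal.toReal_mono (Lp.eLpNorm_ne_top f) h1

/-- The continuous representative of an element of `H¹(ℝ)`. -/
def H1.rep (y : H1) : ℝ → ℝ := fun x =>
  y.hasWeakDeriv.exists_primitive.choose + ∫ z in (0 : ℝ)..x, y.1.2 z

lemma H1.rep_ae_eq (y : H1) : y.1.1 =ᵐ[volume] y.rep :=
  y.hasWeakDeriv.exists_primitive.choose_spec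

lemma H1.continuous_rep (y : H1) : Continuous y.rep :=
  continuous_primitive y.1.2.locallyIntegrable _

lemma H1.rep_eq_of_continuous (y : H1) {f : ℝ → ℝ} (hf : Continuous f)
    (h : y.1.1 =ᵐ[volume] f) : y.rep = f :=
  (Continuous.ae_eq_iff_eq volume y.continuous_rep hf).1 (y.rep_ae_eq.symm.trans h)

/-- Compare the value at `x` with the value at `z` in the unit interval to its right, at the cost of
the integral of the derivative, and average over `z`. Each of the two unit-interval integrals is at
most `‖y‖`, hence the factor 2. -/
lemma H1.abs_rep_le (y : H1) (x : ℝ) : |y.rep x| ≤ 2 * ‖y‖ := by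
  have hi : ∀ a b, IntervalIntegrable y.1.2 volume a b :=
    intervalIntegrable_of_locallyIntegrable y.1.2.locallyIntegrable
  have hle : ∀ z ∈ Ioc x (x + 1), |y.rep x| ≤ |y.rep z| + ‖y‖ := by
    intro z hz
    have h1 : y.rep x = y.rep z - ∫ w in x..z, y.1.2 w := by
      simp only [H1.rep]
      rw [← intervalIntegral.integral_add_adjacent_intervals (hi 0 x) (hi x z)]
      ring
    have h2 : |∫ w in x..z, y.1.2 w| ≤ ‖y‖ := by
      refine le_trans ?_ ((setIntegral_unit_le_norm y.1.2 x).trans y.norm_snd_le)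
      rw [intervalIntegral.integral_of_le hz.1.le, ← Real.norm_eq_abs]
      refine (norm_integral_le_integral_norm _).trans ?_
      refine setIntegral_mono_set ?_ (ae_of_all _ fun _ => norm_nonneg _)
        (Ioc_subset_Ioc_right hz.2).eventuallyLE
      have := (hi x (x + 1)).norm
      rwa [intervalIntegrable_iff_integrableOn_Ioc_of_le (by linarith)] at this
    rw [h1]
    exact (abs_sub _ _).trans (by linarith)
  have i1 : IntegrableOn (fun z => |y.rep z|) (Ioc x (x + 1)) :=
    (y.continuous_rep.abs.integrableOn_Icc).mono_set Ioc_subset_Icc_self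
  have h3 : ∫ z in Ioc x (x + 1), |y.rep x| ≤ ∫ z in Ioc x (x + 1), (|y.rep z| + ‖y‖) := by
    refine setIntegral_mono_on (by simp) (i1.add (by simp)) measurableSet_Ioc hle
  rw [integral_add i1 (by simp)] at h3
  simp only [integral_const, MeasurableSet.univ, measureReal_restrict_apply, univ_inter,
    Real.volume_real_Ioc, add_sub_cancel_left, smul_eq_mul] at h3
  have h4 : ∫ z in Ioc x (x + 1), |y.rep z| ≤ ‖y‖ := by
    refine le_trans (le_of_eq ?_) ((setIntegral_unit_le_norm y.1.1 x).trans y.norm_fst_le)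
    refine integral_congr_ae (ae_restrict_of_ae ?_)
    filter_upwards [y.rep_ae_eq] with z hz
    rw [hz, Real.norm_eq_abs]
  norm_num at h3
  have h5 : ‖(y : L2R × L2R)‖ = ‖y‖ := rfl
  linarith

/-- Point evaluation on `H¹(ℝ)`. -/
def H1.ev (x : ℝ) : H1 →L[ℝ] ℝ :=
  LinearMap.mkContinuous
    { toFun := fun y => y.rep x
      map_add' := fun y z => by
        have := (y + z).rep_eq_of_continuous (y.continuous_rep.add z.continuous_rep) (by
          refine (Lp.coeFn_add y.1.1 z.1.1).trans ?_
          exact y.rep_ae_eq.add z.rep_ae_eq)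
        rw [this, Pi.add_apply]
      map_smul' := fun c y => by
        have := (c • y).rep_eq_of_continuous (y.continuous_rep.const_smul c) (by
          refine (Lp.coeFn_smul c y.1.1).trans ?_
          exact y.rep_ae_eq.const_smul c)
        rw [this]; rfl }
    2 fun y => y.abs_rep_le x

lemma H1.ev_apply (x : ℝ) (y : H1) : H1.ev x y = y.rep x := rfl

lemma H1.ae_eq_ev (y : H1) : y.1.1 =ᵐ[volume] fun x => H1.ev x y := y.rep_ae_eq

lemma H1.ev_eq_of_continuous (y : H1) {f : ℝ → ℝ} (hf : Continuous f)
    (h : y.1.1 =ᵐ[volume] f) (x : ℝ) : H1.ev x y = f x := by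
  rw [H1.ev_apply, y.rep_eq_of_continuous hf h]

lemma H1.abs_ev_le (y : H1) (x : ℝ) : |H1.ev x y| ≤ 2 * ‖y‖ := y.abs_rep_le x

/-! ### Comparison of the norm of `H1` with `eH1norm` -/

lemma eLpNorm_le_eH1norm (f : ℝ → ℝ) : eLpNorm f 2 volume ≤ eH1norm f := by
  refine le_iInf₂ fun g _ => ?_
  calc eLpNorm f 2 volume = (eLpNorm f 2 volume ^ 2) ^ (1 / 2 : ℝ) := by
        rw [← ENNReal.rpow_natCast, ← ENNReal.rpow_mul]; norm_num
    _ ≤ _ := ENNReal.rpow_le_rpow le_self_add (by norm_num)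

lemma H1.ofReal_norm_le_eH1norm (y : H1) {f : ℝ → ℝ} (h : f =ᵐ[volume] y.1.1) :
    ENNReal.ofReal ‖y‖ ≤ eH1norm f := by
  refine le_iInf₂ fun g hg => ?_
  have hg' : g =ᵐ[volume] y.1.2 := (hg.congr h (EventuallyEq.refl _ _)).ae_unique y.hasWeakDeriv
  rw [eLpNorm_congr_ae h, eLpNorm_congr_ae hg', H1.norm_eq, Lp.norm_def, Lp.norm_def,
    ENNReal.ofReal_max, ENNReal.ofReal_toReal (Lp.eLpNorm_ne_top _),
    ENNReal.ofReal_toReal (Lp.eLpNorm_ne_top _)]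
  have e : ∀ a : ℝ≥0∞, a = (a ^ 2) ^ (1 / 2 : ℝ) := fun a => by
    rw [← ENNReal.rpow_natCast, ← ENNReal.rpow_mul]; norm_num
  refine max_le ?_ ?_
  · refine (e _).le.trans (ENNReal.rpow_le_rpow le_self_add (by norm_num))
  · refine (e _).le.trans (ENNReal.rpow_le_rpow le_add_self (by norm_num))

/-- `H1` inherits the maximum norm of the product, so the Hilbert norm is larger by at most `√2`.
The cruder factor 2 is harmless: the bound serves only for convergence to zero and for the zero
element. -/
lemma H1.eH1norm_le (y : H1) {f : ℝ → ℝ} (h : f =ᵐ[volume] y.1.1) :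
    eH1norm f ≤ ENNReal.ofReal (2 * ‖y‖) := by
  refine (iInf₂_le (y.1.2 : ℝ → ℝ)
    (y.hasWeakDeriv.congr h.symm (EventuallyEq.refl _ _))).trans ?_
  rw [eLpNorm_congr_ae h]
  have h1 : ∀ f : L2R, eLpNorm f 2 volume = ENNReal.ofReal ‖f‖ := fun f => by
    rw [Lp.norm_def, ENNReal.ofReal_toReal (Lp.eLpNorm_ne_top _)]
  rw [h1, h1, ← ENNReal.ofReal_pow (norm_nonneg _), ← ENNReal.ofReal_pow (norm_nonneg _),
    ← ENNReal.ofReal_add (by positivity) (by positivity),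
    ENNReal.ofReal_rpow_of_nonneg (by positivity) (by norm_num), ← Real.sqrt_eq_rpow]
  refine ENNReal.ofReal_le_ofReal (Real.sqrt_le_iff.2 ⟨by positivity, ?_⟩)
  have := y.norm_fst_le
  have := y.norm_snd_le
  nlinarith [norm_nonneg y.1.1, norm_nonneg y.1.2, norm_nonneg y]

/-! ### Convolution with rapidly decaying kernels -/

/-- A continuous kernel with Gaussian decay. -/
structure IsRapid (k : ℝ → ℝ) : Prop where
  cont : Continuous k
  bound : ∃ A a : ℝ, 0 ≤ A ∧ 0 < a ∧ ∀ z, |k z| ≤ A * Real.exp (-a * z ^ 2)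

lemma IsRapid.zero : IsRapid (fun _ => 0) :=
  ⟨continuous_const, 0, 1, le_rfl, one_pos, fun z => by simp⟩

lemma IsRapid.sub {k l : ℝ → ℝ} (hk : IsRapid k) (hl : IsRapid l) :
    IsRapid (fun z => k z - l z) := by
  obtain ⟨A, a, hA, ha, h1⟩ := hk.bound
  obtain ⟨B, b, hB, hb, h2⟩ := hl.bound
  refine ⟨hk.cont.sub hl.cont, A + B, min a b, by positivity, by positivity, fun z => ?_⟩
  have e1 : Real.exp (-a * z ^ 2) ≤ Real.exp (-(min a b) * z ^ 2) :=
    Real.exp_le_exp.2 (by nlinarith [min_le_left a b, sq_nonneg z])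
  have e2 : Real.exp (-b * z ^ 2) ≤ Real.exp (-(min a b) * z ^ 2) :=
    Real.exp_le_exp.2 (by nlinarith [min_le_right a b, sq_nonneg z])
  calc |k z - l z| ≤ |k z| + |l z| := abs_sub _ _
    _ ≤ A * Real.exp (-a * z ^ 2) + B * Real.exp (-b * z ^ 2) := add_le_add (h1 z) (h2 z)
    _ ≤ _ := by nlinarith [mul_le_mul_of_nonneg_left e1 hA, mul_le_mul_of_nonneg_left e2 hB]

lemma IsRapid.integrable {k : ℝ → ℝ} (hk : IsRapid k) : Integrable k := by
  obtain ⟨A, a, hA, ha, h⟩ := hk.bound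
  exact ((integrable_exp_neg_mul_sq ha).const_mul A).mono' hk.cont.aestronglyMeasurable
    (ae_of_all _ h)

lemma IsRapid.exists_abs_le {k : ℝ → ℝ} (hk : IsRapid k) : ∃ A : ℝ, 0 ≤ A ∧ ∀ z, |k z| ≤ A := by
  obtain ⟨A, a, hA, ha, h⟩ := hk.bound
  refine ⟨A, hA, fun z => (h z).trans (mul_le_of_le_one_right hA ?_)⟩
  exact Real.exp_le_one_iff.2 (by nlinarith [sq_nonneg z])

lemma IsRapid.memLp {k : ℝ → ℝ} (hk : IsRapid k) : MemLp k 2 volume := by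
  rw [memLp_two_iff_integrable_sq hk.cont.aestronglyMeasurable]
  obtain ⟨A, hA, h⟩ := hk.exists_abs_le
  refine (hk.integrable.norm.const_mul A).mono' (hk.cont.pow 2).aestronglyMeasurable
    (ae_of_all _ fun z => ?_)
  rw [norm_pow, Real.norm_eq_abs, sq]
  exact mul_le_mul_of_nonneg_right (h z) (abs_nonneg _)

lemma memLp_comp_sub_left {k : ℝ → ℝ} (hk : MemLp k 2 volume) (x : ℝ) :
    MemLp (fun y => k (x - y)) 2 volume :=
  hk.comp_measurePreserving (volume.measurePreserving_sub_left x)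

/-- Convolution of two functions on the line. -/
def convFn (k f : ℝ → ℝ) (x : ℝ) : ℝ := ∫ y, k (x - y) * f y

lemma IsRapid.integrable_conv {k f : ℝ → ℝ} (hk : IsRapid k) (hf : MemLp f 2 volume) (x : ℝ) :
    Integrable (fun y => k (x - y) * f y) :=
  (memLp_comp_sub_left hk.memLp x).integrable_mul hf

lemma convFn_congr {k f g : ℝ → ℝ} (h : f =ᵐ[volume] g) : convFn k f = convFn k g := by
  funext x
  refine integral_congr_ae ?_
  filter_upwards [h] with y hy
  rw [hy]

/-- A locally uniform integrable bound for the convolution integrand. -/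
lemma IsRapid.exists_dominated {k f : ℝ → ℝ} (hk : IsRapid k) (hf : MemLp f 2 volume) (x₀ : ℝ) :
    ∃ b : ℝ → ℝ, Integrable b ∧ ∀ x ∈ Metric.ball x₀ 1, ∀ y, ‖k (x - y) * f y‖ ≤ b y := by
  obtain ⟨A, a, hA, ha, h⟩ := hk.bound
  -- From `(x₀ - y)² ≤ 2(x - y)² + 2(x - x₀)²` and `|x - x₀| < 1`: moving the centre within the unit
  -- ball halves the decay rate and costs a factor `exp a`.
  have hr : IsRapid (fun z => A * Real.exp a * Real.exp (-(a / 2) * z ^ 2)) :=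
    ⟨by fun_prop, A * Real.exp a, a / 2, by positivity, by positivity, fun z =>
      (abs_of_nonneg (by positivity)).le⟩
  refine ⟨fun y => ‖A * Real.exp a * Real.exp (-(a / 2) * (x₀ - y) ^ 2) * f y‖,
    (hr.integrable_conv hf x₀).norm, fun x hx y => ?_⟩
  simp only [norm_mul (_ * _) (f y), norm_mul (k _)]
  refine mul_le_mul_of_nonneg_right ?_ (norm_nonneg _)
  rw [Real.norm_eq_abs, Real.norm_eq_abs, abs_of_nonneg (by positivity : 0 ≤ A * Real.exp a *
    Real.exp (-(a / 2) * (x₀ - y) ^ 2))]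
  refine (h _).trans ?_
  rw [mul_assoc, ← Real.exp_add]
  refine mul_le_mul_of_nonneg_left (Real.exp_le_exp.2 ?_) hA
  have hx' : |x - x₀| < 1 := by simpa [Real.dist_eq] using hx
  have h1 : (x - x₀) ^ 2 ≤ 1 := by
    have := abs_lt.1 hx'
    nlinarith
  nlinarith [sq_nonneg ((x - y) + (x - x₀))]

lemma IsRapid.continuous_convFn {k f : ℝ → ℝ} (hk : IsRapid k) (hf : MemLp f 2 volume) :
    Continuous (convFn k f) := by
  refine continuous_iff_continuousAt.2 fun x₀ => ?_
  obtain ⟨b, hb, hle⟩ := hk.exists_dominated hf x₀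
  refine continuousAt_of_dominated (bound := b) ?_ ?_ hb ?_
  · exact Eventually.of_forall fun x => (hk.integrable_conv hf x).aestronglyMeasurable
  · filter_upwards [Metric.ball_mem_nhds x₀ one_pos] with x hx
    exact ae_of_all _ (hle x hx)
  · refine ae_of_all _ fun y => ?_
    exact ((hk.cont.comp (continuous_id.sub continuous_const)).mul continuous_const).continuousAt

lemma IsRapid.hasDerivAt_convFn {k k' f : ℝ → ℝ} (hk : IsRapid k) (hk' : IsRapid k')
    (hd : ∀ z, HasDerivAt k (k' z) z) (hf : MemLp f 2 volume) (x : ℝ) :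
    HasDerivAt (convFn k f) (convFn k' f x) x := by
  obtain ⟨b, hb, hle⟩ := hk'.exists_dominated hf x
  refine (hasDerivAt_integral_of_dominated_loc_of_deriv_le (Metric.ball_mem_nhds x one_pos)
    (F := fun x y => k (x - y) * f y) (F' := fun x y => k' (x - y) * f y)
    (bound := b) ?_ (hk.integrable_conv hf x)
    (hk'.integrable_conv hf x).aestronglyMeasurable ?_ hb ?_).2
  · exact Eventually.of_forall fun x => (hk.integrable_conv hf x).aestronglyMeasurable
  · exact ae_of_all _ fun y x hx => hle x hx y
  · refine ae_of_all _ fun y z _ => ?_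
    have := (hd (z - y)).comp z ((hasDerivAt_id z).sub_const y)
    simp only [mul_one] at this
    exact this.mul_const (f y)

lemma IsRapid.hasWeakDeriv_convFn {k k' f : ℝ → ℝ} (hk : IsRapid k) (hk' : IsRapid k')
    (hd : ∀ z, HasDerivAt k (k' z) z) (hf : MemLp f 2 volume) :
    HasWeakDeriv (convFn k f) (convFn k' f) := by
  have h1 := fun x => hk.hasDerivAt_convFn hk' hd hf x
  have h2 : deriv (convFn k f) = convFn k' f := funext fun x => (h1 x).deriv
  rw [← h2]
  refine hasWeakDeriv_of_contDiff (contDiff_one_iff_deriv.2 ⟨fun x => (h1 x).differentiableAt, ?_⟩)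
  rw [h2]
  exact hk'.continuous_convFn hf

/-- Young's inequality for a convolution with an integrable kernel on `L²`. -/
lemma IsRapid.eLpNorm_convFn_le {k f : ℝ → ℝ} (hk : IsRapid k) (hf : MemLp f 2 volume) :
    eLpNorm (convFn k f) 2 volume ≤ (∫⁻ z, ‖k z‖ₑ) * eLpNorm f 2 volume := by
  have hkm : Measurable k := hk.cont.measurable
  wlog hfm : Measurable f generalizing f
  · obtain ⟨g, hgm, hfg⟩ := hf.1
    rw [convFn_congr hfg, eLpNorm_congr_ae hfg]
    exact this ((memLp_congr_ae hfg).1 hf) hgm.measurable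
  have htr : ∀ x, ∫⁻ y, ‖k (x - y)‖ₑ = ∫⁻ z, ‖k z‖ₑ := fun x =>
    lintegral_sub_left_eq_self (fun z => ‖k z‖ₑ) x
  have htr' : ∀ y, ∫⁻ x, ‖k (x - y)‖ₑ = ∫⁻ z, ‖k z‖ₑ := fun y =>
    lintegral_sub_right_eq_self (fun z => ‖k z‖ₑ) y
  set K := ∫⁻ z, ‖k z‖ₑ with hK
  -- Cauchy–Schwarz after writing `|k|` as a product of two square roots; only one of them is kept
  -- with `f`, so Tonelli then produces the second factor `K`.
  have hpt : ∀ x, ‖convFn k f x‖ₑ ^ (2 : ℝ) ≤ K * ∫⁻ y, ‖k (x - y)‖ₑ * ‖f y‖ₑ ^ (2 : ℝ) := by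
    intro x
    have h1 : ‖convFn k f x‖ₑ ≤ ∫⁻ y, ‖k (x - y)‖ₑ ^ (1 / 2 : ℝ) *
        (‖k (x - y)‖ₑ ^ (1 / 2 : ℝ) * ‖f y‖ₑ) := by
      refine (enorm_integral_le_lintegral_enorm _).trans (le_of_eq (lintegral_congr fun y => ?_))
      rw [enorm_mul, ← mul_assoc, ← ENNReal.rpow_add_of_nonneg _ _ (by norm_num) (by norm_num)]
      norm_num
    have h2 := ENNReal.lintegral_mul_le_Lp_mul_Lq (volume : Measure ℝ)
      (Real.HolderConjugate.two_two) (f := fun y => ‖k (x - y)‖ₑ ^ (1 / 2 : ℝ))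
      (g := fun y => ‖k (x - y)‖ₑ ^ (1 / 2 : ℝ) * ‖f y‖ₑ)
      (by fun_prop) (by fun_prop)
    have h3 := ENNReal.rpow_le_rpow (h1.trans h2) (by norm_num : (0 : ℝ) ≤ 2)
    rw [ENNReal.mul_rpow_of_nonneg _ _ (by norm_num), ← ENNReal.rpow_mul, ← ENNReal.rpow_mul] at h3
    refine h3.trans (le_of_eq ?_)
    norm_num
    congr 1
    · rw [← htr x]
      refine lintegral_congr fun y => ?_
      rw [← ENNReal.rpow_natCast, ← ENNReal.rpow_mul]
      norm_num
    · refine lintegral_congr fun y => ?_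
      rw [mul_pow, ← ENNReal.rpow_natCast, ← ENNReal.rpow_mul]
      norm_num
  have h4 : ∫⁻ x, ‖convFn k f x‖ₑ ^ (2 : ℝ) ≤ K ^ (2 : ℝ) * ∫⁻ y, ‖f y‖ₑ ^ (2 : ℝ) := by
    refine (lintegral_mono hpt).trans ?_
    rw [lintegral_const_mul _ (Measurable.lintegral_prod_right' (f := fun p : ℝ × ℝ =>
      ‖k (p.1 - p.2)‖ₑ * ‖f p.2‖ₑ ^ (2 : ℝ)) (by fun_prop)),
      lintegral_lintegral_swap (by fun_prop)]
    have : ∀ y, ∫⁻ x, ‖k (x - y)‖ₑ * ‖f y‖ₑ ^ (2 : ℝ) = K * ‖f y‖ₑ ^ (2 : ℝ) := fun y => by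
      rw [lintegral_mul_const _ (by fun_prop), htr']
    simp only [this]
    rw [lintegral_const_mul _ (by fun_prop), ← mul_assoc, ENNReal.rpow_two, sq]
  rw [eLpNorm_eq_lintegral_rpow_enorm_toReal (by norm_num) (by norm_num),
    eLpNorm_eq_lintegral_rpow_enorm_toReal (by norm_num) (by norm_num)]
  simp only [ENNReal.toReal_ofNat]
  refine (ENNReal.rpow_le_rpow h4 (by norm_num)).trans (le_of_eq ?_)
  rw [ENNReal.mul_rpow_of_nonneg _ _ (by norm_num), ← ENNReal.rpow_mul]
  norm_num

lemma IsRapid.lintegral_eq {k : ℝ → ℝ} (hk : IsRapid k) :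
    ∫⁻ z, ‖k z‖ₑ = ENNReal.ofReal (∫ z, ‖k z‖) :=
  (ofReal_integral_norm_eq_lintegral_enorm hk.integrable).symm

lemma IsRapid.memLp_convFn {k f : ℝ → ℝ} (hk : IsRapid k) (hf : MemLp f 2 volume) :
    MemLp (convFn k f) 2 volume := by
  refine ⟨(hk.continuous_convFn hf).aestronglyMeasurable, (hk.eLpNorm_convFn_le hf).trans_lt ?_⟩
  rw [hk.lintegral_eq]
  exact ENNReal.mul_lt_top ENNReal.ofReal_lt_top hf.2

/-- Convolution with a rapidly decaying kernel as an operator on `L²(ℝ)`. -/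
def convOp (k : ℝ → ℝ) (hk : IsRapid k) : L2R →L[ℝ] L2R :=
  LinearMap.mkContinuous
    { toFun := fun f => (hk.memLp_convFn (Lp.memLp f)).toLp _
      map_add' := fun f g => by
        rw [← MemLp.toLp_add]
        refine MemLp.toLp_congr _ _ (ae_of_all _ fun x => ?_)
        rw [convFn_congr (Lp.coeFn_add f g), Pi.add_apply, convFn, convFn, convFn,
          ← integral_add (hk.integrable_conv (Lp.memLp f) x) (hk.integrable_conv (Lp.memLp g) x)]
        simp [mul_add]
      map_smul' := fun c f => by
        rw [RingHom.id_apply, ← MemLp.toLp_const_smul]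
        refine MemLp.toLp_congr _ _ (ae_of_all _ fun x => ?_)
        rw [convFn_congr (Lp.coeFn_smul c f), Pi.smul_apply, convFn, convFn, smul_eq_mul,
          ← integral_const_mul]
        refine integral_congr_ae (ae_of_all _ fun y => ?_)
        simp only [Pi.smul_apply, smul_eq_mul]
        ring }
    (∫ z, ‖k z‖) fun f => by
      have h := hk.eLpNorm_convFn_le (Lp.memLp f)
      rw [hk.lintegral_eq] at h
      rw [LinearMap.coe_mk, AddHom.coe_mk, Lp.norm_toLp, Lp.norm_def]
      refine (ENNReal.toReal_mono (ENNReal.mul_ne_top ENNReal.ofReal_ne_top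
        (Lp.eLpNorm_ne_top f)) h).trans (le_of_eq ?_)
      rw [ENNReal.toReal_mul, ENNReal.toReal_ofReal (integral_nonneg fun _ => norm_nonneg _)]

lemma convOp_ae_eq {k : ℝ → ℝ} (hk : IsRapid k) (f : L2R) :
    convOp k hk f =ᵐ[volume] convFn k f :=
  MemLp.coeFn_toLp (hk.memLp_convFn (Lp.memLp f))

lemma norm_convOp_le {k : ℝ → ℝ} (hk : IsRapid k) : ‖convOp k hk‖ ≤ ∫ z, ‖k z‖ :=
  LinearMap.mkContinuous_norm_le _ (integral_nonneg fun _ => norm_nonneg _) _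

lemma convOp_sub {k l : ℝ → ℝ} (hk : IsRapid k) (hl : IsRapid l) :
    convOp k hk - convOp l hl = convOp (fun z => k z - l z) (hk.sub hl) := by
  ext1 f
  refine Lp.ext ((Lp.coeFn_sub _ _).trans ?_)
  filter_upwards [convOp_ae_eq hk f, convOp_ae_eq hl f, convOp_ae_eq (hk.sub hl) f]
    with x h1 h2 h3
  rw [Pi.sub_apply]
  refine (congrArg₂ (· - ·) h1 h2).trans ?_
  rw [h3, convFn, convFn, convFn,
    ← integral_sub (hk.integrable_conv (Lp.memLp f) x) (hl.integrable_conv (Lp.memLp f) x)]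
  simp [sub_mul]

/-! ### The heat semigroup from `L²(ℝ)` to `H¹(ℝ)` -/

/-- The parabolic rescaling of a kernel; it vanishes for `τ ≤ 0`. -/
def dil (k : ℝ → ℝ) (τ z : ℝ) : ℝ := (Real.sqrt τ)⁻¹ * k (z / Real.sqrt τ)

lemma dil_of_nonpos (k : ℝ → ℝ) {τ : ℝ} (hτ : τ ≤ 0) : dil k τ = fun _ => 0 := by
  funext z; simp [dil, Real.sqrt_eq_zero_of_nonpos hτ]

lemma IsRapid.const_mul {k : ℝ → ℝ} (hk : IsRapid k) (c : ℝ) : IsRapid (fun z => c * k z) := by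
  obtain ⟨A, a, hA, ha, hb⟩ := hk.bound
  refine ⟨continuous_const.mul hk.cont, |c| * A, a, by positivity, ha, fun z => ?_⟩
  rw [abs_mul, mul_assoc]
  exact mul_le_mul_of_nonneg_left (hb z) (abs_nonneg c)

lemma IsRapid.dil {k : ℝ → ℝ} (hk : IsRapid k) (τ : ℝ) : IsRapid (dil k τ) := by
  rcases le_or_gt τ 0 with h | h
  · rw [dil_of_nonpos k h]; exact IsRapid.zero
  · obtain ⟨A, a, hA, ha, hb⟩ := hk.bound
    refine ⟨by unfold ShockDisplacement.dil; have := hk.cont; fun_prop,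
      (Real.sqrt τ)⁻¹ * A, a / τ, by positivity,
      by positivity, fun z => ?_⟩
    rw [ShockDisplacement.dil, abs_mul, abs_of_nonneg (by positivity : 0 ≤ (Real.sqrt τ)⁻¹),
      mul_assoc]
    refine mul_le_mul_of_nonneg_left ((hb _).trans (le_of_eq ?_)) (by positivity)
    rw [div_pow, Real.sq_sqrt h.le]
    ring_nf

/-- Parabolic rescaling preserves the `L¹` norm, which makes convolution bounds uniform in time. -/
lemma integral_norm_dil_le (k : ℝ → ℝ) (τ : ℝ) : ∫ z, ‖dil k τ z‖ ≤ ∫ z, ‖k z‖ := by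
  rcases le_or_gt τ 0 with h | h
  · rw [dil_of_nonpos k h]; simp only [norm_zero, integral_zero]
    exact integral_nonneg fun _ => norm_nonneg _
  · have hs : 0 < Real.sqrt τ := Real.sqrt_pos.2 h
    have : ∀ z, ‖dil k τ z‖ = (Real.sqrt τ)⁻¹ * ‖k (z / Real.sqrt τ)‖ := fun z => by
      rw [dil, norm_mul, Real.norm_of_nonneg (by positivity)]
    simp only [this]
    rw [integral_const_mul, Measure.integral_comp_div (fun z => ‖k z‖), abs_of_pos hs, smul_eq_mul,
      ← mul_assoc, inv_mul_cancel₀ hs.ne', one_mul]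

lemma hasDerivAt_dil {k k' : ℝ → ℝ} (hd : ∀ z, HasDerivAt k (k' z) z) (τ z : ℝ) :
    HasDerivAt (dil k τ) ((Real.sqrt τ)⁻¹ * dil k' τ z) z := by
  have h1 := ((hd (z / Real.sqrt τ)).comp z ((hasDerivAt_id z).div_const (Real.sqrt τ))).const_mul
    (Real.sqrt τ)⁻¹
  convert! h1 using 1
  simp only [dil, one_div]
  ring

/-- Operator norms are bounded by `L¹` norms of kernels, so dominated convergence gives continuity
in operator norm, with one Gaussian dominating all `τ` between `σ/2` and `2σ`. Norm continuity is
what yields joint continuity of `heatOp` in time and datum. -/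
lemma IsRapid.continuousAt_convOp_dil {k : ℝ → ℝ} (hk : IsRapid k) {σ : ℝ} (hσ : 0 < σ) :
    ContinuousAt (fun τ => convOp (ShockDisplacement.dil k τ) (hk.dil τ)) σ := by
  rw [ContinuousAt, tendsto_iff_norm_sub_tendsto_zero]
  have hlim : Tendsto (fun τ => ∫ z, ‖ShockDisplacement.dil k τ z - ShockDisplacement.dil k σ z‖)
      (𝓝 σ) (𝓝 (∫ z, ‖ShockDisplacement.dil k σ z - ShockDisplacement.dil k σ z‖)) := by
    obtain ⟨A, a, hA, ha, hb⟩ := hk.bound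
    have hr : IsRapid (fun z => (Real.sqrt (σ / 2))⁻¹ * A * Real.exp (-(a / (2 * σ)) * z ^ 2)) :=
      ⟨by fun_prop, (Real.sqrt (σ / 2))⁻¹ * A, a / (2 * σ), by positivity, by positivity,
        fun z => (abs_of_nonneg (by positivity)).le⟩
    refine tendsto_integral_filter_of_dominated_convergence
      (fun z => (Real.sqrt (σ / 2))⁻¹ * A * Real.exp (-(a / (2 * σ)) * z ^ 2) +
        ‖ShockDisplacement.dil k σ z‖) ?_ ?_ (hr.integrable.add (hk.dil σ).integrable.norm) ?_
    · exact Eventually.of_forall fun τ =>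
        ((hk.dil τ).cont.sub (hk.dil σ).cont).norm.aestronglyMeasurable
    · filter_upwards [Ioo_mem_nhds (half_lt_self hσ) (by linarith : σ < 2 * σ)] with τ hτ
      refine ae_of_all _ fun z => ?_
      rw [norm_norm]
      refine (norm_sub_le _ _).trans (add_le_add_left ?_ _)
      have hτ0 : 0 < τ := by linarith [hτ.1]
      rw [ShockDisplacement.dil, norm_mul, Real.norm_of_nonneg (by positivity), mul_assoc]
      refine mul_le_mul (inv_anti₀ (Real.sqrt_pos.2 (by positivity))
        (Real.sqrt_le_sqrt hτ.1.le)) ((hb _).trans (mul_le_mul_of_nonneg_left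
          (Real.exp_le_exp.2 ?_) hA)) (norm_nonneg _) (by positivity)
      rw [div_pow, Real.sq_sqrt hτ0.le]
      have h1 : a / (2 * σ) ≤ a / τ := div_le_div_of_nonneg_left ha.le hτ0 hτ.2.le
      have h2 : a * (z ^ 2 / τ) = a / τ * z ^ 2 := by ring
      nlinarith [sq_nonneg z]
    · refine ae_of_all _ fun z => ?_
      have h1 : ContinuousAt (fun τ => ShockDisplacement.dil k τ z) σ := by
        have hs : Real.sqrt σ ≠ 0 := (Real.sqrt_pos.2 hσ).ne'
        unfold ShockDisplacement.dil
        refine (Real.continuous_sqrt.continuousAt.inv₀ hs).mul ?_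
        exact hk.cont.continuousAt.comp
          (continuousAt_const.div Real.continuous_sqrt.continuousAt hs)
      exact (h1.sub continuousAt_const).norm
  simp only [sub_self, norm_zero, integral_zero] at hlim
  refine squeeze_zero (fun _ => norm_nonneg _) (fun τ => ?_) hlim
  rw [convOp_sub]
  exact norm_convOp_le _

/-! ### The heat kernel and its smoothing bounds -/

/-- The heat kernel at time one. -/
def gaussK (D z : ℝ) : ℝ := 1 / Real.sqrt (4 * Real.pi * D) * Real.exp (-z ^ 2 / (4 * D))

/-- The derivative of the heat kernel at time one. -/
def gaussK' (D z : ℝ) : ℝ := -(z / (2 * D)) * gaussK D z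

lemma hasDerivAt_gaussK (D z : ℝ) : HasDerivAt (gaussK D) (gaussK' D z) z := by
  have h1 : HasDerivAt (fun z : ℝ => -z ^ 2 / (4 * D)) (-(z / (2 * D))) z := by
    have := ((hasDerivAt_pow 2 z).neg).div_const (4 * D)
    convert! this using 1
    by_cases hD : D = 0
    · simp [hD]
    · field_simp; norm_num [mul_comm]
  have h2 := (h1.exp).const_mul (1 / Real.sqrt (4 * Real.pi * D))
  convert! h2 using 1
  simp only [gaussK', gaussK]
  ring

section Heat
variable {D : ℝ}

lemma isRapid_gaussK (hD : 0 < D) : IsRapid (gaussK D) := by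
  refine ⟨by unfold gaussK; fun_prop, 1 / Real.sqrt (4 * Real.pi * D), 1 / (4 * D), by positivity,
    by positivity, fun z => ?_⟩
  rw [abs_of_nonneg (by unfold gaussK; positivity), gaussK]
  refine le_of_eq ?_
  congr 2
  ring

/-- Half of the Gaussian decay is spent on absorbing the factor `|z|`, so the rate drops from
`1/(4D)` to `1/(8D)`. -/
lemma isRapid_gaussK' (hD : 0 < D) : IsRapid (gaussK' D) := by
  refine ⟨by unfold gaussK' gaussK; fun_prop,
    1 / (2 * D) * (1 + 8 * D) * (1 / Real.sqrt (4 * Real.pi * D)), 1 / (8 * D),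
    by positivity, by positivity, fun z => ?_⟩
  have h0 : 0 ≤ gaussK D z := by unfold gaussK; positivity
  rw [gaussK', abs_mul, abs_of_nonneg h0, abs_neg, abs_div, abs_of_pos (by positivity : 0 < 2 * D)]
  have h1 : |z| ≤ (1 + 8 * D) * Real.exp (1 / (8 * D) * z ^ 2) := by
    have h2 := Real.add_one_le_exp (1 / (8 * D) * z ^ 2)
    have h3 : |z| ≤ 1 + z ^ 2 := by nlinarith [sq_abs z, sq_nonneg (|z| - 1)]
    have h4 : 1 + z ^ 2 ≤ (1 + 8 * D) * (1 / (8 * D) * z ^ 2 + 1) := by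
      have : (1 + 8 * D) * (1 / (8 * D) * z ^ 2 + 1) =
          1 + z ^ 2 + 8 * D + 1 / (8 * D) * z ^ 2 := by field_simp; ring
      rw [this]
      have : 0 ≤ 1 / (8 * D) * z ^ 2 := by positivity
      linarith
    exact h3.trans (h4.trans (mul_le_mul_of_nonneg_left h2 (by positivity)))
  have h5 : gaussK D z = 1 / Real.sqrt (4 * Real.pi * D) *
      (Real.exp (-(1 / (8 * D) * z ^ 2)) * Real.exp (-(1 / (8 * D)) * z ^ 2)) := by
    rw [gaussK, ← Real.exp_add]
    congr 2
    field_simp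
    ring
  rw [h5]
  calc |z| / (2 * D) * (1 / Real.sqrt (4 * Real.pi * D) *
      (Real.exp (-(1 / (8 * D) * z ^ 2)) * Real.exp (-(1 / (8 * D)) * z ^ 2)))
      ≤ ((1 + 8 * D) * Real.exp (1 / (8 * D) * z ^ 2)) / (2 * D) *
        (1 / Real.sqrt (4 * Real.pi * D) *
      (Real.exp (-(1 / (8 * D) * z ^ 2)) * Real.exp (-(1 / (8 * D)) * z ^ 2))) := by gcongr
    _ = _ := by
        rw [Real.exp_neg (1 / (8 * D) * z ^ 2)]
        field_simp

lemma heat_eq_convFn {τ : ℝ} (hτ : 0 < τ) (f : ℝ → ℝ) :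
    heat D τ f = convFn (dil (gaussK D) τ) f := by
  funext x
  rw [heat, if_neg hτ.ne', convFn]
  refine integral_congr_ae (ae_of_all _ fun y => ?_)
  simp only [dil, gaussK]
  rw [Real.sqrt_mul' _ hτ.le, div_pow, Real.sq_sqrt hτ.le]
  congr 1
  rw [one_div, mul_inv, ← mul_assoc, mul_comm (Real.sqrt τ)⁻¹, one_div]
  congr 2
  by_cases hD : D = 0
  · simp [hD]
  · field_simp

/-- The heat semigroup as an operator from `L²(ℝ)` to `H¹(ℝ)` (zero for nonpositive times). -/
def heatOp (hD : 0 < D) (τ : ℝ) : L2R →L[ℝ] H1 :=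
  ((convOp (dil (gaussK D) τ) ((isRapid_gaussK hD).dil τ)).prod
    ((Real.sqrt τ)⁻¹ • convOp (dil (gaussK' D) τ) ((isRapid_gaussK' hD).dil τ))).codRestrict H1sub
  fun f => by
    have h := (((isRapid_gaussK hD).dil τ).hasWeakDeriv_convFn (k' := fun z => (Real.sqrt τ)⁻¹ *
      dil (gaussK' D) τ z)
      (((isRapid_gaussK' hD).dil τ).const_mul _)
      (hasDerivAt_dil (hasDerivAt_gaussK D) τ) (Lp.memLp f))
    refine h.congr (convOp_ae_eq _ f).symm ?_
    refine EventuallyEq.symm ((Lp.coeFn_smul _ _).trans ?_)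
    filter_upwards [convOp_ae_eq ((isRapid_gaussK' hD).dil τ) f] with x hx
    rw [Pi.smul_apply]
    refine (congrArg ((Real.sqrt τ)⁻¹ • ·) hx).trans ?_
    simp only [convFn, smul_eq_mul]
    rw [← integral_const_mul]
    refine integral_congr_ae (ae_of_all _ fun y => ?_)
    ring

lemma heatOp_fst (hD : 0 < D) (τ : ℝ) (f : L2R) :
    (heatOp hD τ f).1.1 = convOp (dil (gaussK D) τ) ((isRapid_gaussK hD).dil τ) f := rfl

lemma heatOp_snd (hD : 0 < D) (τ : ℝ) (f : L2R) :
    (heatOp hD τ f).1.2 =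
      (Real.sqrt τ)⁻¹ • convOp (dil (gaussK' D) τ) ((isRapid_gaussK' hD).dil τ) f := rfl

/-- At `τ = 0` this disagrees with the identity, but in Duhamel integrals that concerns only the
null set `s = t`. Vanishing for `τ < 0` lets the noise term be integrated over all of `[0,T]` rather
than up to `t`. -/
lemma heatOp_of_nonpos (hD : 0 < D) {τ : ℝ} (hτ : τ ≤ 0) (f : L2R) : heatOp hD τ f = 0 := by
  refine H1.ext_fst ?_
  rw [heatOp_fst]
  refine Lp.ext ((convOp_ae_eq _ f).trans ?_)
  refine EventuallyEq.trans ?_ (Lp.coeFn_zero ℝ 2 volume).symm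
  refine ae_of_all _ fun x => ?_
  simp [convFn, dil_of_nonpos _ hτ]

lemma ev_heatOp (hD : 0 < D) {τ : ℝ} (hτ : 0 < τ) (f : L2R) (x : ℝ) :
    H1.ev x (heatOp hD τ f) = heat D τ f x := by
  rw [heat_eq_convFn hτ]
  exact H1.ev_eq_of_continuous _
    (((isRapid_gaussK hD).dil τ).continuous_convFn (Lp.memLp f)) (convOp_ae_eq _ f) x

lemma continuousAt_heatOp (hD : 0 < D) {τ : ℝ} (hτ : 0 < τ) (f : L2R) :
    ContinuousAt (fun p : ℝ × L2R => heatOp hD p.1 p.2) (τ, f) := by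
  rw [Topology.IsInducing.subtypeVal.continuousAt_iff]
  have h1 : ∀ {k : ℝ → ℝ} (hk : IsRapid k),
      ContinuousAt (fun p : ℝ × L2R => convOp (dil k p.1) (hk.dil p.1) p.2) (τ, f) := fun hk =>
    (ContinuousAt.comp (f := fun p : ℝ × L2R => p.1) (x := (τ, f))
      (hk.continuousAt_convOp_dil hτ) continuousAt_fst).clm_apply continuousAt_snd
  refine (h1 (isRapid_gaussK hD)).prodMk (ContinuousAt.smul ?_ (h1 (isRapid_gaussK' hD)))
  exact (Real.continuous_sqrt.continuousAt.comp continuousAt_fst).inv₀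
    (Real.sqrt_pos.2 hτ).ne'

/-- Smoothing estimate for the heat semigroup. -/
lemma norm_heatOp_le (hD : 0 < D) (T : ℝ) : ∃ C : ℝ, 0 ≤ C ∧ ∀ τ, 0 < τ → τ ≤ T → ∀ f : L2R,
    ‖heatOp hD τ f‖ ≤ C * (Real.sqrt τ)⁻¹ * ‖f‖ := by
  have hn : ∀ k : ℝ → ℝ, 0 ≤ ∫ z, ‖k z‖ := fun k => integral_nonneg fun _ => norm_nonneg _
  have hop : ∀ {k : ℝ → ℝ} (hk : IsRapid k) (τ : ℝ) (f : L2R),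
      ‖convOp (dil k τ) (hk.dil τ) f‖ ≤ (∫ z, ‖k z‖) * ‖f‖ := fun hk τ f =>
    ((convOp _ (hk.dil τ)).le_opNorm f).trans (mul_le_mul_of_nonneg_right
      ((norm_convOp_le _).trans (integral_norm_dil_le _ _)) (norm_nonneg _))
  -- The function component has no singularity; the factor `√T` lets it share the singular form,
  -- since `1 ≤ √T / √τ`.
  refine ⟨(∫ z, ‖gaussK D z‖) * Real.sqrt T + ∫ z, ‖gaussK' D z‖,
    add_nonneg (mul_nonneg (hn _) (Real.sqrt_nonneg _)) (hn _), fun τ hτ hT f => ?_⟩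
  have hs : 0 < Real.sqrt τ := Real.sqrt_pos.2 hτ
  have hsT : 1 ≤ Real.sqrt T * (Real.sqrt τ)⁻¹ := by
    rw [← div_eq_mul_inv, one_le_div hs]; exact Real.sqrt_le_sqrt hT
  rw [H1.norm_eq]
  refine max_le ?_ ?_
  · rw [heatOp_fst]
    refine (hop (isRapid_gaussK hD) τ f).trans (mul_le_mul_of_nonneg_right ?_ (norm_nonneg _))
    have h1 := mul_le_mul_of_nonneg_left hsT (hn (gaussK D))
    have h2 := mul_nonneg (hn (gaussK' D)) (inv_nonneg.2 hs.le)
    nlinarith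
  · rw [heatOp_snd, norm_smul, Real.norm_of_nonneg (by positivity)]
    refine (mul_le_mul_of_nonneg_left (hop (isRapid_gaussK' hD) τ f) (by positivity)).trans ?_
    rw [← mul_assoc, mul_comm (Real.sqrt τ)⁻¹]
    refine mul_le_mul_of_nonneg_right (mul_le_mul_of_nonneg_right ?_ (by positivity))
      (norm_nonneg _)
    have := mul_nonneg (hn (gaussK D)) (Real.sqrt_nonneg T)
    linarith

/-- Integration by parts: the derivative may be moved from the kernel to the function. -/
lemma IsRapid.convFn_deriv_eq {k k' : ℝ → ℝ} (hk : IsRapid k) (hk' : IsRapid k')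
    (hd : ∀ z, HasDerivAt k (k' z) z) (y : H1) (x : ℝ) :
    convFn k' y.1.1 x = convFn k y.1.2 x := by
  obtain ⟨c, hc⟩ := y.hasWeakDeriv.exists_primitive
  have hloc := y.1.2.locallyIntegrable
  set p : ℝ → ℝ := fun x => c + ∫ z in (0 : ℝ)..x, y.1.2 z with hp
  have hpe : y.rep = p := y.rep_eq_of_continuous (continuous_primitive hloc c) hc
  have hpb : ∀ z, |p z| ≤ 2 * ‖y‖ := fun z => hpe ▸ y.abs_rep_le z
  rw [convFn_congr hc]
  have hpm : MemLp p 2 volume := (memLp_congr_ae hc).1 (Lp.memLp y.1.1)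
  have hdk : ∀ z, HasDerivAt (fun z => k (x - z)) (-k' (x - z)) z := fun z => by
    have := (hd (x - z)).comp z ((hasDerivAt_id z).const_sub x)
    simp only [mul_neg, mul_one] at this
    exact this
  have hcd : ContDiff ℝ 1 (fun z => k (x - z)) := by
    refine contDiff_one_iff_deriv.2 ⟨fun z => (hdk z).differentiableAt, ?_⟩
    rw [show deriv (fun z => k (x - z)) = fun z => -k' (x - z) from
      funext fun z => (hdk z).deriv]
    exact (hk'.cont.comp (continuous_const.sub continuous_id)).neg
  have hparts : ∀ n : ℕ, ∫ z in (-(n + 1 : ℝ))..(n + 1 : ℝ), k' (x - z) * p z =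
      (∫ z in (-(n + 1 : ℝ))..(n + 1 : ℝ), k (x - z) * y.1.2 z) -
        (p (n + 1) * k (x - (n + 1)) - p (-(n + 1)) * k (x - (-(n + 1)))) := by
    intro n
    have h1 := (absolutelyContinuous_primitive hloc c (n + 1)
      (by positivity)).integral_mul_deriv_eq_deriv_mul
        (hcd.contDiffOn.absolutelyContinuousOnInterval)
    have h2 : ∫ z in (-(n + 1 : ℝ))..(n + 1 : ℝ), p z * deriv (fun z => k (x - z)) z =
        -∫ z in (-(n + 1 : ℝ))..(n + 1 : ℝ), k' (x - z) * p z := by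
      rw [← intervalIntegral.integral_neg]
      refine intervalIntegral.integral_congr fun z _ => ?_
      simp only [(hdk z).deriv]
      ring
    have h3 : ∫ z in (-(n + 1 : ℝ))..(n + 1 : ℝ), deriv p z * k (x - z) =
        ∫ z in (-(n + 1 : ℝ))..(n + 1 : ℝ), k (x - z) * y.1.2 z := by
      refine intervalIntegral.integral_congr_ae ?_
      filter_upwards [ae_hasDerivAt_primitive hloc c] with z hz _
      rw [hz.deriv, mul_comm]
    rw [h2, h3] at h1
    linarith
  have htop : Tendsto (fun n : ℕ => (n + 1 : ℝ)) atTop atTop :=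
    tendsto_atTop_add_const_right _ _ tendsto_natCast_atTop_atTop
  have hbot : Tendsto (fun n : ℕ => -(n + 1 : ℝ)) atTop atBot :=
    tendsto_neg_atTop_atBot.comp htop
  have l1 := intervalIntegral_tendsto_integral (hk'.integrable_conv hpm x) hbot htop
  have l2 := intervalIntegral_tendsto_integral (hk.integrable_conv (Lp.memLp y.1.2) x) hbot htop
  have hk0 : Tendsto k (cocompact ℝ) (𝓝 0) := by
    obtain ⟨A, a, hA, ha, hb⟩ := hk.bound
    rw [tendsto_zero_iff_abs_tendsto_zero]
    refine squeeze_zero (fun _ => abs_nonneg _) hb ?_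
    have h1 : Tendsto (fun z : ℝ => a * z ^ 2) (cocompact ℝ) atTop := by
      have := (tendsto_norm_cocompact_atTop (E := ℝ))
      have h2 := ((tendsto_pow_atTop two_ne_zero).comp this).const_mul_atTop ha
      refine h2.congr fun z => ?_
      simp
    have h3 := (Real.tendsto_exp_neg_atTop_nhds_zero.comp h1).const_mul A
    simpa using h3
  -- Boundary terms vanish because the representative is bounded by `2 * ‖y‖` while the kernel
  -- decays at infinity.
  have hkb : ∀ q : ℕ → ℝ, Tendsto q atTop (cocompact ℝ) →
      Tendsto (fun n => p (q n) * k (x - q n)) atTop (𝓝 0) := by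
    intro q hq
    have h1 : Tendsto (fun n => k (x - q n)) atTop (𝓝 0) :=
      hk0.comp ((Homeomorph.subLeft x).isClosedEmbedding.tendsto_cocompact.comp hq)
    exact bdd_le_mul_tendsto_zero' (2 * ‖y‖) (Eventually.of_forall fun n => hpb _) h1
  have l3 := hkb _ (htop.mono_right atTop_le_cocompact)
  have l4 := hkb _ (hbot.mono_right atBot_le_cocompact)
  refine tendsto_nhds_unique l1 ?_
  simp only [hparts]
  have := l2.sub (l3.sub l4)
  simpa [convFn] using this

/-- On `H¹` data the derivative commutes with the heat flow, so no factor `τ^{-1/2}` appears. The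
noise term needs this: `(t-s)^{-1/2}` is not square integrable in `s` and could not serve as the
dominating function paired with an `L²` control. -/
lemma norm_heatOp_H1_le (hD : 0 < D) (τ : ℝ) (y : H1) :
    ‖heatOp hD τ y.1.1‖ ≤ (∫ z, ‖gaussK D z‖) * ‖y‖ := by
  have hn : 0 ≤ ∫ z, ‖gaussK D z‖ := integral_nonneg fun _ => norm_nonneg _
  have hop : ∀ f : L2R, ‖convOp (dil (gaussK D) τ) ((isRapid_gaussK hD).dil τ) f‖ ≤
      (∫ z, ‖gaussK D z‖) * ‖f‖ := fun f =>
    ((convOp _ ((isRapid_gaussK hD).dil τ)).le_opNorm f).trans (mul_le_mul_of_nonneg_right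
      ((norm_convOp_le _).trans (integral_norm_dil_le _ _)) (norm_nonneg _))
  have e : (heatOp hD τ y.1.1).1.2 =
      convOp (dil (gaussK D) τ) ((isRapid_gaussK hD).dil τ) y.1.2 := by
    have h1 := (heatOp hD τ y.1.1).hasWeakDeriv
    have hr := ((isRapid_gaussK' hD).dil τ).const_mul (Real.sqrt τ)⁻¹
    have h2 := ((isRapid_gaussK hD).dil τ).hasWeakDeriv_convFn hr
      (hasDerivAt_dil (hasDerivAt_gaussK D) τ) (Lp.memLp y.1.1)
    rw [show convFn (fun z => (Real.sqrt τ)⁻¹ * dil (gaussK' D) τ z) y.1.1 =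
      convFn (dil (gaussK D) τ) y.1.2 from funext fun x =>
        ((isRapid_gaussK hD).dil τ).convFn_deriv_eq hr
          (hasDerivAt_dil (hasDerivAt_gaussK D) τ) y x] at h2
    refine Lp.ext ?_
    exact h1.ae_unique (h2.congr (convOp_ae_eq _ _).symm (convOp_ae_eq _ _).symm)
  rw [H1.norm_eq, e, heatOp_fst]
  exact max_le ((hop _).trans (mul_le_mul_of_nonneg_left y.norm_fst_le hn))
    ((hop _).trans (mul_le_mul_of_nonneg_left y.norm_snd_le hn))

end Heat

/-! ### The nonlinearity -/

/-- The derivative of a viscous profile is square integrable. -/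
lemma IsWaveProfile.memLp_deriv {F U : ℝ → ℝ} {D uL uR : ℝ} (hF : Continuous F)
    (hU : IsWaveProfile F D uL uR U) : MemLp (deriv U) 2 volume := by
  have hc : Continuous (deriv U) := hU.contDiff.continuous_deriv (by norm_num)
  rw [memLp_two_iff_integrable_sq hc.aestronglyMeasurable]
  set q : ℝ → ℝ := fun v => F v - F uL - waveSpeed F uL uR * (v - uL) with hq
  have hqc : Continuous q := by fun_prop
  set G : ℝ → ℝ := fun v => ∫ w in (0 : ℝ)..v, q w with hG
  have hGd : ∀ v, HasDerivAt G (q v) v := fun v =>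
    (hqc.integral_hasStrictDerivAt 0 v).hasDerivAt
  have hGc : Continuous G := continuous_iff_continuousAt.2 fun v => (hGd v).continuousAt
  -- By the profile equation one factor of `(U')²` is `q(U)/D`, so `(U')²` is an exact derivative
  -- and its integral is governed by the limits of `U` at infinity.
  have hd : ∀ x, HasDerivAt (fun x => 1 / D * G (U x)) (deriv U x ^ 2) x := fun x => by
    have h1 := ((hGd (U x)).comp x
      ((hU.contDiff.differentiable (by norm_num) x).hasDerivAt)).const_mul (1 / D)
    have e : deriv U x ^ 2 = 1 / D * (q (U x) * deriv U x) := by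
      rw [sq]; nth_rewrite 1 [hU.ode x]; simp only [hq]; ring
    rw [e]; exact h1
  have hint : ∀ a b, ∫ x in a..b, deriv U x ^ 2 = 1 / D * G (U b) - 1 / D * G (U a) :=
    fun a b => intervalIntegral.integral_eq_sub_of_hasDerivAt (fun x _ => hd x)
      ((hc.pow 2).intervalIntegrable a b)
  refine integrable_of_intervalIntegral_norm_tendsto (l := atTop) (a := fun r : ℝ => -r)
    (b := fun r : ℝ => r) (1 / D * G uR - 1 / D * G uL)
    (fun r => ((hc.pow 2).integrableOn_Icc).mono_set Ioc_subset_Icc_self)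
    tendsto_neg_atTop_atBot tendsto_id ?_
  have e : ∀ r : ℝ, ∫ x in (-r)..r, ‖deriv U x ^ 2‖ = 1 / D * G (U r) - 1 / D * G (U (-r)) :=
    fun r => by
      rw [← hint]
      exact intervalIntegral.integral_congr fun x _ => by simp
  simp only [e]
  exact (((hGc.tendsto uR).comp hU.tendsto_atTop).const_mul _).sub
    (((hGc.tendsto uL).comp (hU.tendsto_atBot.comp tendsto_neg_atTop_atBot)).const_mul _)

/-- The hypotheses on the flux `F` and on the reference profile `U`. -/
structure FluxData (F U : ℝ → ℝ) (C : ℝ) : Prop where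
  contDiff : ContDiff ℝ 2 F
  deriv_le : ∀ v, |deriv F v| ≤ C
  deriv2_le : ∀ v, |deriv (deriv F) v| ≤ C
  profile : ContDiff ℝ 1 U
  memLp : MemLp (deriv U) 2 volume

section Flux
variable {F U : ℝ → ℝ} {C : ℝ}

lemma FluxData.nonneg (h : FluxData F U C) : 0 ≤ C := (abs_nonneg _).trans (h.deriv_le 0)

lemma FluxData.continuous_deriv (h : FluxData F U C) : Continuous (deriv F) :=
  h.contDiff.continuous_deriv (by norm_num)

lemma FluxData.deriv_lip (h : FluxData F U C) (a b : ℝ) :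
    |deriv F a - deriv F b| ≤ C * |a - b| := by
  have hd : ContDiff ℝ 1 (deriv F) := by
    have h2 : ContDiff ℝ (1 + 1) F := by simpa [one_add_one_eq_two] using h.contDiff
    exact (contDiff_succ_iff_deriv.1 h2).2.2
  have := (lipschitzWith_of_nnnorm_deriv_le (C := ⟨C, h.nonneg⟩)
    (hd.differentiable one_ne_zero) fun x => h.deriv2_le x).dist_le_mul a b
  rwa [Real.dist_eq, Real.dist_eq] at this

lemma FluxData.memLp_nonlin (h : FluxData F U C) (v : H1) :
    MemLp (fun x => deriv F (U x + v.1.1 x) * (deriv U x + v.1.2 x)) 2 volume := by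
  refine (h.memLp.add (Lp.memLp v.1.2)).mul (p := ⊤) (r := 2) ?_
  refine memLp_top_of_bound ?_ C (ae_of_all _ fun x => h.deriv_le _)
  exact h.continuous_deriv.comp_aestronglyMeasurable
    (h.profile.continuous.aestronglyMeasurable.add (Lp.aestronglyMeasurable v.1.1))

/-- The map `v ↦ ∂ₓ F(U + v)` from `H¹(ℝ)` to `L²(ℝ)`. -/
def FluxData.nonlin (h : FluxData F U C) (v : H1) : L2R := (h.memLp_nonlin v).toLp _

lemma FluxData.nonlin_ae_eq (h : FluxData F U C) (v : H1) :
    h.nonlin v =ᵐ[volume] fun x => deriv F (U x + v.1.1 x) * (deriv U x + v.1.2 x) :=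
  MemLp.coeFn_toLp _

lemma FluxData.weakDeriv_ae_eq (h : FluxData F U C) (v : H1) {u : ℝ → ℝ}
    (hu : (fun x => u x - U x) =ᵐ[volume] v.1.1) :
    weakDeriv (fun x => F (u x)) =ᵐ[volume] h.nonlin v := by
  have h1 := ((hasWeakDeriv_of_contDiff h.profile).add v.hasWeakDeriv).comp
    (h.contDiff.of_le (by norm_num)) h.deriv_le
  refine (h1.congr ?_ (h.nonlin_ae_eq v).symm).weakDeriv_ae_eq
  filter_upwards [hu] with x hx
  rw [← hx]; ring_nf

/-- Split the difference as `F'(U+v)(v'-w') + (F'(U+v)-F'(U+w))(U'+w')` and bound the increment of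
`F'` by the sup norm of `v - w`. The Lipschitz constant involves the size of `w` alone, so a bound
on one of the two curves suffices for stability. -/
lemma FluxData.nonlin_sub_le (h : FluxData F U C) (v w : H1) :
    ‖h.nonlin v - h.nonlin w‖ ≤ C * (1 + 2 * (‖h.memLp.toLp (deriv U)‖ + ‖w‖)) * ‖v - w‖ := by
  set b : L2R := h.memLp.toLp (deriv U) with hb
  have hC := h.nonneg
  have key : ‖h.nonlin v - h.nonlin w‖ ≤
      ‖(C • |v.1.2 - w.1.2| + (C * (2 * ‖v - w‖)) • |b + w.1.2| : L2R)‖ := by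
    refine Lp.norm_le_norm_of_ae_le ?_
    filter_upwards [Lp.coeFn_sub (h.nonlin v) (h.nonlin w), h.nonlin_ae_eq v, h.nonlin_ae_eq w,
      Lp.coeFn_add (C • |v.1.2 - w.1.2|) ((C * (2 * ‖v - w‖)) • |b + w.1.2|),
      Lp.coeFn_smul C (|v.1.2 - w.1.2|), Lp.coeFn_smul (C * (2 * ‖v - w‖)) |b + w.1.2|,
      Lp.coeFn_abs (v.1.2 - w.1.2), Lp.coeFn_abs (b + w.1.2), Lp.coeFn_sub v.1.2 w.1.2,
      Lp.coeFn_add b w.1.2, h.memLp.coeFn_toLp, (v - w).ae_eq_ev, Lp.coeFn_sub v.1.1 w.1.1]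
      with x e1 e2 e3 e4 e5 e6 e7 e8 e9 e10 e11 e12 e13
    rw [e1, e4, Pi.sub_apply, Pi.add_apply, e2, e3, e5, e6, Pi.smul_apply, Pi.smul_apply, e7, e8,
      e9, e10, Pi.sub_apply, Pi.add_apply, hb, e11, smul_eq_mul, smul_eq_mul, Real.norm_eq_abs,
      Real.norm_eq_abs]
    have hev : |v.1.1 x - w.1.1 x| ≤ 2 * ‖v - w‖ := by
      have : v.1.1 x - w.1.1 x = H1.ev x (v - w) := by rw [← e12]; exact e13.symm
      rw [this]; exact (v - w).abs_ev_le x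
    have e : deriv F (U x + v.1.1 x) * (deriv U x + v.1.2 x) -
        deriv F (U x + w.1.1 x) * (deriv U x + w.1.2 x) =
        deriv F (U x + v.1.1 x) * (v.1.2 x - w.1.2 x) +
        (deriv F (U x + v.1.1 x) - deriv F (U x + w.1.1 x)) * (deriv U x + w.1.2 x) := by ring
    rw [e]
    refine le_trans ?_ (le_abs_self _)
    refine (abs_add_le _ _).trans (add_le_add ?_ ?_)
    · rw [abs_mul]
      exact mul_le_mul_of_nonneg_right (h.deriv_le _) (abs_nonneg _)
    · rw [abs_mul]
      refine mul_le_mul_of_nonneg_right ((h.deriv_lip _ _).trans ?_) (abs_nonneg _)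
      refine mul_le_mul_of_nonneg_left ?_ hC
      rwa [add_sub_add_left_eq_sub]
  refine key.trans ((norm_add_le _ _).trans ?_)
  rw [norm_smul, norm_smul, norm_abs_eq_norm, norm_abs_eq_norm, Real.norm_of_nonneg hC,
    Real.norm_of_nonneg (by positivity)]
  have h1 : ‖v.1.2 - w.1.2‖ ≤ ‖v - w‖ := (v - w).norm_snd_le
  have h2 : ‖b + w.1.2‖ ≤ ‖b‖ + ‖w‖ := (norm_add_le _ _).trans (by linarith [w.norm_snd_le])
  have h3 := mul_le_mul_of_nonneg_left h1 hC
  have h4 := mul_le_mul_of_nonneg_left h2 (by positivity : 0 ≤ C * (2 * ‖v - w‖))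
  linarith

lemma FluxData.continuous_nonlin (h : FluxData F U C) : Continuous h.nonlin := by
  refine continuous_iff_continuousAt.2 fun w => ?_
  rw [ContinuousAt, tendsto_iff_norm_sub_tendsto_zero]
  have h1 : Tendsto (fun v : H1 => ‖v - w‖) (𝓝 w) (𝓝 0) :=
    tendsto_iff_norm_sub_tendsto_zero.1 tendsto_id
  refine squeeze_zero (fun _ => norm_nonneg _) (fun v => h.nonlin_sub_le v w) ?_
  simpa using h1.const_mul (C * (1 + 2 * (‖h.memLp.toLp (deriv U)‖ + ‖w‖)))

end Flux

/-! ### The Duhamel operator -/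

lemma intervalIntegrable_inv_sqrt {t : ℝ} (ht : 0 ≤ t) :
    IntervalIntegrable (fun s => (Real.sqrt (t - s))⁻¹) volume 0 t := by
  have h1 : IntervalIntegrable (fun x : ℝ => x ^ (-(1 / 2) : ℝ)) volume 0 t :=
    intervalIntegral.intervalIntegrable_rpow' (by norm_num)
  have h2 := h1.comp_sub_left t
  simp only [sub_zero, sub_self] at h2
  refine h2.symm.congr fun s hs => ?_
  rw [uIoc_of_le ht] at hs
  rw [Real.rpow_neg (sub_nonneg.2 hs.2), Real.sqrt_eq_rpow]

section Duhamel
variable {D : ℝ}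

/-- The Duhamel integral `∫₀ᵗ S(t-s) N(s) ds`. -/
def duhamel (hD : 0 < D) (N : ℝ → L2R) (t : ℝ) : H1 := ∫ s in (0 : ℝ)..t, heatOp hD (t - s) (N s)

/-- The endpoint `s = t` is excluded: joint continuity of `heatOp` is available only at positive
times. -/
lemma continuousOn_heatOp_comp (hD : 0 < D) {T t : ℝ} (htT : t ≤ T) {N : ℝ → L2R}
    (hN : ContinuousOn N (Icc 0 T)) :
    ContinuousOn (fun s => heatOp hD (t - s) (N s)) (Ico 0 t) := by
  intro s hs
  have h1 : ContinuousWithinAt (fun s => (t - s, N s)) (Ico 0 t) s :=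
    ContinuousWithinAt.prodMk (by fun_prop)
      ((hN s ⟨hs.1, hs.2.le.trans htT⟩).mono fun r hr => ⟨hr.1, hr.2.le.trans htT⟩)
  exact (continuousAt_heatOp hD (sub_pos.2 hs.2) (N s)).comp_continuousWithinAt
    (f := fun s => (t - s, N s)) h1

lemma aestronglyMeasurable_heatOp_comp (hD : 0 < D) {T t : ℝ} (htT : t ≤ T)
    {N : ℝ → L2R} (hN : ContinuousOn N (Icc 0 T)) :
    AEStronglyMeasurable (fun s => heatOp hD (t - s) (N s)) (volume.restrict (Ioc 0 t)) := by
  have h1 := (continuousOn_heatOp_comp hD htT hN).aestronglyMeasurable measurableSet_Ico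
    (μ := volume)
  rwa [Measure.restrict_congr_set Ico_ae_eq_Ioc] at h1

lemma intervalIntegrable_heatOp_comp (hD : 0 < D) {T t : ℝ} (ht : t ∈ Icc 0 T) {N : ℝ → L2R}
    (hN : ContinuousOn N (Icc 0 T)) :
    IntervalIntegrable (fun s => heatOp hD (t - s) (N s)) volume 0 t := by
  obtain ⟨C, hC, hle⟩ := norm_heatOp_le hD T
  obtain ⟨M, hM⟩ := isCompact_Icc.exists_bound_of_continuousOn hN
  refine ((intervalIntegrable_inv_sqrt ht.1).const_mul (C * M)).mono_fun' ?_ ?_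
  · rw [uIoc_of_le ht.1]
    exact aestronglyMeasurable_heatOp_comp hD ht.2 hN
  · rw [uIoc_of_le ht.1]
    filter_upwards [ae_restrict_mem measurableSet_Ioc] with s hs
    have hM0 : 0 ≤ M := (norm_nonneg _).trans (hM t ht)
    rcases hs.2.lt_or_eq with h | h
    · refine (hle (t - s) (sub_pos.2 h) (by linarith [hs.1, ht.2]) _).trans ?_
      rw [mul_right_comm]
      have := hM s ⟨hs.1.le, hs.2.trans ht.2⟩
      gcongr
    · rw [h, sub_self, heatOp_of_nonpos hD le_rfl]
      simp

/-- Point evaluation is continuous and linear on `H1`, so it passes inside the Bochner integral.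
This links the `H¹`-valued equation with the pointwise integrals of the mild formulation. -/
lemma ev_duhamel (hD : 0 < D) {T t : ℝ} (ht : t ∈ Icc 0 T) {N : ℝ → L2R}
    (hN : ContinuousOn N (Icc 0 T)) (x : ℝ) :
    H1.ev x (duhamel hD N t) = ∫ s in (0 : ℝ)..t, heat D (t - s) (N s) x := by
  rw [duhamel, ← (H1.ev x).intervalIntegral_comp_comm (intervalIntegrable_heatOp_comp hD ht hN)]
  refine intervalIntegral.integral_congr_ae ?_
  have : ∀ᵐ s : ℝ, s ≠ t := by simp [ae_iff]
  filter_upwards [this] with s hst hs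
  rw [uIoc_of_le ht.1] at hs
  exact ev_heatOp hD (sub_pos.2 (lt_of_le_of_ne hs.2 hst)) _ x

lemma norm_duhamel_sub_le (hD : 0 < D) {T C : ℝ}
    (hle : ∀ τ, 0 < τ → τ ≤ T → ∀ f : L2R, ‖heatOp hD τ f‖ ≤ C * (Real.sqrt τ)⁻¹ * ‖f‖)
    (hC : 0 ≤ C) {t : ℝ} (ht : t ∈ Icc 0 T) {N M : ℝ → L2R} (hN : ContinuousOn N (Icc 0 T))
    (hM : ContinuousOn M (Icc 0 T)) {L : ℝ} {d : ℝ → ℝ}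
    (hd : ContinuousOn d (Icc 0 T)) (hd0 : ∀ s ∈ Icc 0 T, ‖N s - M s‖ ≤ L * d s) :
    ‖duhamel hD N t - duhamel hD M t‖ ≤
      C * L * ∫ s in (0 : ℝ)..t, (Real.sqrt (t - s))⁻¹ * d s := by
  rw [duhamel, duhamel, ← intervalIntegral.integral_sub (intervalIntegrable_heatOp_comp hD ht hN)
    (intervalIntegrable_heatOp_comp hD ht hM), ← intervalIntegral.integral_const_mul]
  refine intervalIntegral.norm_integral_le_of_norm_le ht.1 ?_ ?_
  · refine ae_of_all _ fun s hs => ?_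
    rw [← map_sub]
    have hs' : s ∈ Icc 0 T := ⟨hs.1.le, hs.2.trans ht.2⟩
    rcases hs.2.lt_or_eq with h | h
    · refine (hle (t - s) (sub_pos.2 h) (by linarith [hs.1, ht.2]) _).trans ?_
      refine (mul_le_mul_of_nonneg_left (hd0 s hs') (by positivity)).trans (le_of_eq ?_)
      ring
    · rw [h, sub_self, heatOp_of_nonpos hD le_rfl]
      simp
  · refine IntervalIntegrable.const_mul ?_ _
    refine (intervalIntegrable_inv_sqrt ht.1).mul_continuousOn ?_
    rw [uIcc_of_le ht.1]
    exact hd.mono (Icc_subset_Icc_right ht.2)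

/-! ### The singular Gronwall inequality -/

lemma exists_weight (K : ℝ) (hK : 0 ≤ K) : ∃ l : ℝ, 0 < l ∧ ∀ t, 0 ≤ t →
    K * ∫ s in (0 : ℝ)..t, (Real.sqrt (t - s))⁻¹ * Real.exp (l * s) ≤ Real.exp (l * t) / 2 := by
  set g := Real.Gamma (1 / 2) with hg
  have hg0 : 0 < g := Real.Gamma_pos_of_pos (by norm_num)
  -- Against the weight `exp(r² s)` the singular integral is at most `exp(r² t) Γ(1/2) / r`. This
  -- `r` makes `K Γ(1/2) / r` at most one half.
  set r := 2 * K * g + 1 with hr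
  have hr0 : 0 < r := by positivity
  refine ⟨r ^ 2, by positivity, fun t ht => ?_⟩
  have h1 := Real.integral_rpow_mul_exp_neg_mul_Ioi (a := 1 / 2) (r := r ^ 2) (by norm_num)
    (by positivity)
  -- Integrability is read off from the nonzero Gamma integral, since a non-integrable function has
  -- integral zero by convention.
  have h2 : IntegrableOn (fun x : ℝ => x ^ ((1 / 2 : ℝ) - 1) * Real.exp (-(r ^ 2 * x))) (Ioi 0) :=
    .of_integral_ne_zero (by rw [h1]; positivity)
  have h3 : ∫ s in (0 : ℝ)..t, (Real.sqrt (t - s))⁻¹ * Real.exp (r ^ 2 * s) =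
      Real.exp (r ^ 2 * t) * ∫ x in (0 : ℝ)..t,
        x ^ ((1 / 2 : ℝ) - 1) * Real.exp (-(r ^ 2 * x)) := by
    rw [← intervalIntegral.integral_const_mul]
    have := intervalIntegral.integral_comp_sub_left (a := 0) (b := t)
      (fun x => Real.exp (r ^ 2 * t) *
      (x ^ ((1 / 2 : ℝ) - 1) * Real.exp (-(r ^ 2 * x)))) t
    simp only [sub_self, sub_zero] at this
    rw [← this]
    refine intervalIntegral.integral_congr_ae (ae_of_all _ fun s hs => ?_)
    rw [uIoc_of_le ht] at hs
    have e : Real.exp (r ^ 2 * s) = Real.exp (r ^ 2 * t) * Real.exp (-(r ^ 2 * (t - s))) := by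
      rw [← Real.exp_add]; ring_nf
    rw [e, Real.sqrt_eq_rpow, ← Real.rpow_neg (sub_nonneg.2 hs.2)]
    norm_num
    ring
  have h4 : ∫ x in (0 : ℝ)..t, x ^ ((1 / 2 : ℝ) - 1) * Real.exp (-(r ^ 2 * x)) ≤ r⁻¹ * g := by
    rw [intervalIntegral.integral_of_le ht]
    have e : (1 / r ^ 2) ^ (1 / 2 : ℝ) * Real.Gamma (1 / 2) = r⁻¹ * g := by
      rw [← Real.sqrt_eq_rpow, one_div, Real.sqrt_inv, Real.sqrt_sq hr0.le]
    rw [← e, ← h1]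
    refine setIntegral_mono_set h2 ?_ Ioc_subset_Ioi_self.eventuallyLE
    filter_upwards [ae_restrict_mem measurableSet_Ioi] with x hx
    have : 0 < x := hx
    positivity
  rw [h3]
  have h5 : K * (r⁻¹ * g) ≤ 1 / 2 := by
    rw [show K * (r⁻¹ * g) = K * g / r by ring, div_le_iff₀ hr0]
    linarith
  have h6 := mul_le_mul_of_nonneg_left h4 hK
  nlinarith [Real.exp_pos (r ^ 2 * t)]

/-- A Gronwall inequality with the singular kernel `(t-s)^{-1/2}`. -/
lemma singular_gronwall (T K : ℝ) (hT : 0 ≤ T) (hK : 0 ≤ K) : ∃ G : ℝ, 0 ≤ G ∧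
    ∀ (d : ℝ → ℝ) (e : ℝ), 0 ≤ e → ContinuousOn d (Icc 0 T) →
    (∀ t ∈ Icc 0 T, d t ≤ e + K * ∫ s in (0 : ℝ)..t, (Real.sqrt (t - s))⁻¹ * d s) →
    ∀ t ∈ Icc 0 T, d t ≤ G * e := by
  obtain ⟨l, hl, hw⟩ := exists_weight K hK
  refine ⟨2 * Real.exp (l * T), by positivity, fun d e he hd h t ht => ?_⟩
  -- At a maximum point of the weighted function the hypothesis reads `M ≤ e + M/2` when `M > 0`, so
  -- `M ≤ 2e`; no iteration is needed.
  obtain ⟨t₁, ht₁, hmax⟩ := isCompact_Icc.exists_isMaxOn (nonempty_Icc.2 hT)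
    (f := fun t => Real.exp (-(l * t)) * d t) (ContinuousOn.mul (by fun_prop) hd)
  set M := Real.exp (-(l * t₁)) * d t₁ with hM
  have hb : ∀ s ∈ Icc 0 T, d s ≤ M * Real.exp (l * s) := fun s hs => by
    have h1 : Real.exp (-(l * s)) * d s ≤ M := hmax hs
    have h2 := mul_le_mul_of_nonneg_right h1 (Real.exp_pos (l * s)).le
    rwa [mul_right_comm, ← Real.exp_add, neg_add_cancel, Real.exp_zero, one_mul] at h2
  have hM2 : M ≤ 2 * e := by
    by_contra! hcon
    have hM0 : 0 < M := by linarith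
    have h1 : ∫ s in (0 : ℝ)..t₁, (Real.sqrt (t₁ - s))⁻¹ * d s ≤
        M * ∫ s in (0 : ℝ)..t₁, (Real.sqrt (t₁ - s))⁻¹ * Real.exp (l * s) := by
      rw [← intervalIntegral.integral_const_mul]
      refine intervalIntegral.integral_mono_on ht₁.1 ?_ ?_ fun s hs => ?_
      · refine (intervalIntegrable_inv_sqrt ht₁.1).mul_continuousOn ?_
        rw [uIcc_of_le ht₁.1]
        exact hd.mono (Icc_subset_Icc_right ht₁.2)
      · refine IntervalIntegrable.const_mul ?_ _
        exact (intervalIntegrable_inv_sqrt ht₁.1).mul_continuousOn (by fun_prop)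
      · have := mul_le_mul_of_nonneg_left (hb s ⟨hs.1, hs.2.trans ht₁.2⟩)
          (inv_nonneg.2 (Real.sqrt_nonneg (t₁ - s)))
        linarith
    have h2 := h t₁ ht₁
    have h3 := hw t₁ ht₁.1
    have h4 : d t₁ ≤ e + M * (Real.exp (l * t₁) / 2) := by
      have := mul_le_mul_of_nonneg_left h1 hK
      have := mul_le_mul_of_nonneg_left h3 hM0.le
      linarith
    have h5 : M ≤ Real.exp (-(l * t₁)) * e + M / 2 := by
      have h6 := mul_le_mul_of_nonneg_left h4 (Real.exp_pos (-(l * t₁))).le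
      have h7 : Real.exp (-(l * t₁)) * (e + M * (Real.exp (l * t₁) / 2)) =
          Real.exp (-(l * t₁)) * e + M / 2 * (Real.exp (-(l * t₁)) * Real.exp (l * t₁)) := by ring
      rw [h7, ← Real.exp_add, neg_add_cancel, Real.exp_zero, mul_one] at h6
      exact h6
    have h8 : Real.exp (-(l * t₁)) ≤ 1 :=
      Real.exp_le_one_iff.2 (by nlinarith [ht₁.1])
    nlinarith
  have h9 : Real.exp (l * t) ≤ Real.exp (l * T) :=
    Real.exp_le_exp.2 (mul_le_mul_of_nonneg_left ht.2 hl.le)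
  calc d t ≤ M * Real.exp (l * t) := hb t ht
    _ ≤ 2 * e * Real.exp (l * t) := mul_le_mul_of_nonneg_right hM2 (Real.exp_pos _).le
    _ ≤ 2 * e * Real.exp (l * T) := mul_le_mul_of_nonneg_left h9 (by positivity)
    _ = _ := by ring

end Duhamel

/-! ### Square integrable kernels as `L²`-valued functions -/

lemma eLpNorm_two_sq {α E : Type*} [MeasurableSpace α] [NormedAddCommGroup E] (μ : Measure α)
    (f : α → E) : eLpNorm f 2 μ ^ 2 = ∫⁻ a, ‖f a‖ₑ ^ 2 ∂μ := by
  rw [eLpNorm_eq_lintegral_rpow_enorm_toReal (by norm_num) (by norm_num), ← ENNReal.rpow_natCast,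
    ← ENNReal.rpow_mul]
  norm_num

/-- A map into a separable metric space is measurable once all distances to points are. -/
lemma measurable_of_measurable_dist {α X : Type*} [MeasurableSpace α] [PseudoMetricSpace X]
    [SecondCountableTopology X] [MeasurableSpace X] [BorelSpace X] {f : α → X}
    (h : ∀ c, Measurable fun a => dist (f a) c) : Measurable f := by
  refine measurable_of_isOpen fun V hV => ?_
  choose! r hr hsub using fun x (hx : x ∈ V) => Metric.isOpen_iff.1 hV x hx
  -- Lindelöf property: countably many of the balls inside `V` already cover it.
  obtain ⟨T, hTV, hTc, hT⟩ := TopologicalSpace.isOpen_biUnion_countable V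
    (fun x => Metric.ball x (r x)) fun x _ => Metric.isOpen_ball
  have hV' : V = ⋃ x ∈ T, Metric.ball x (r x) := by
    rw [hT]
    refine Subset.antisymm (fun x hx => ?_) (iUnion₂_subset hsub)
    exact mem_iUnion₂.2 ⟨x, hx, Metric.mem_ball_self (hr x hx)⟩
  rw [hV', preimage_iUnion₂]
  exact MeasurableSet.biUnion hTc fun x _ => measurableSet_lt (h x) measurable_const

instance : SecondCountableTopology L2R :=
  have : Fact ((2 : ℝ≥0∞) ≠ ⊤) := ⟨by norm_num⟩
  Lp.SecondCountableTopology

section Sec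
variable {α : Type*}

open Classical in
/-- The `L²` class of a section of a kernel (zero if it is not square integrable). -/
def sec (g : α → ℝ → ℝ) (a : α) : L2R := if h : MemLp (g a) 2 volume then h.toLp (g a) else 0

lemma sec_ae_eq {g : α → ℝ → ℝ} {a : α} (h : MemLp (g a) 2 volume) : sec g a =ᵐ[volume] g a := by
  rw [sec, dif_pos h]; exact h.coeFn_toLp

lemma enorm_sec {g : α → ℝ → ℝ} {a : α} (h : MemLp (g a) 2 volume) :
    ‖sec g a‖ₑ = eLpNorm (g a) 2 volume := by
  rw [Lp.enorm_def, eLpNorm_congr_ae (sec_ae_eq h)]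

variable [MeasurableSpace α] {μ : Measure α}

lemma lintegral_eLpNorm_sq [SFinite μ] {g : α → ℝ → ℝ}
    (hg : AEStronglyMeasurable (Function.uncurry g) (μ.prod volume)) :
    ∫⁻ a, eLpNorm (g a) 2 volume ^ 2 ∂μ = eLpNorm (Function.uncurry g) 2 (μ.prod volume) ^ 2 := by
  rw [eLpNorm_two_sq, lintegral_prod _ (by fun_prop)]
  exact lintegral_congr fun a => eLpNorm_two_sq _ _

lemma ae_memLp_sec [SFinite μ] {g : α → ℝ → ℝ}
    (hg : MemLp (Function.uncurry g) 2 (μ.prod volume)) : ∀ᵐ a ∂μ, MemLp (g a) 2 volume := by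
  have h1 := lintegral_eLpNorm_sq hg.1
  have h2 : ∀ᵐ a ∂μ, eLpNorm (g a) 2 volume ^ 2 < ⊤ := by
    refine ae_lt_top' ?_ ?_
    · simp only [eLpNorm_two_sq]
      exact (hg.1.enorm.pow_const 2).lintegral_prod_right'
    · rw [h1]; exact ENNReal.pow_ne_top hg.2.ne
  filter_upwards [h2, hg.1.prodMk_left] with a ha hm
  exact ⟨hm, by simpa using ha⟩

/-- For a jointly measurable representative, the distance from a section to a fixed `L²` function is
a Tonelli integral in the second variable, hence measurable, and measurable distances suffice in the
separable space `L2R`. -/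
lemma aestronglyMeasurable_sec [SFinite μ] {g : α → ℝ → ℝ}
    (hg : MemLp (Function.uncurry g) 2 (μ.prod volume)) : AEStronglyMeasurable (sec g) μ := by
  classical
  borelize L2R
  obtain ⟨G, hGm, hG⟩ := hg.1
  set g' : α → ℝ → ℝ := fun a x => G (a, x) with hg'
  have hae : sec g =ᵐ[μ] sec g' := by
    filter_upwards [Measure.ae_ae_of_ae_prod hG] with a ha
    have ha' : g a =ᵐ[volume] g' a := ha
    by_cases h : MemLp (g a) 2 volume
    · rw [sec, sec, dif_pos h, dif_pos ((memLp_congr_ae ha').1 h)]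
      exact MemLp.toLp_congr _ _ ha'
    · rw [sec, sec, dif_neg h, dif_neg fun h' => h ((memLp_congr_ae ha').2 h')]
  refine ⟨sec g', Measurable.stronglyMeasurable ?_, hae⟩
  have hGm' : Measurable G := hGm.measurable
  have hsm : ∀ a, AEStronglyMeasurable (g' a) volume := fun a =>
    (hGm'.comp measurable_prodMk_left).aestronglyMeasurable
  have hset : MeasurableSet {a | MemLp (g' a) 2 volume} := by
    have : {a | MemLp (g' a) 2 volume} = {a | ∫⁻ x, ‖G (a, x)‖ₑ ^ 2 < ⊤} := by
      ext a
      simp only [mem_ofPred_eq, MemLp, hsm a, true_and]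
      rw [← eLpNorm_two_sq volume (fun x => G (a, x))]
      simp [hg']
    rw [this]
    exact measurableSet_lt (hGm'.enorm.pow_const 2).lintegral_prod_right' measurable_const
  refine measurable_of_measurable_dist fun c => ?_
  have hc : Measurable (c : ℝ → ℝ) := (Lp.stronglyMeasurable c).measurable
  have heq : (fun a => dist (sec g' a) c) = {a | MemLp (g' a) 2 volume}.piecewise
      (fun a => ((∫⁻ x, ‖G (a, x) - c x‖ₑ ^ 2) ^ (1 / 2 : ℝ)).toReal) (fun _ => ‖c‖) := by
    funext a
    by_cases h : a ∈ {a | MemLp (g' a) 2 volume}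
    · rw [piecewise_eq_of_mem _ _ _ h, Lp.dist_def,
        eLpNorm_congr_ae ((sec_ae_eq (show MemLp (g' a) 2 volume from h)).sub
          (EventuallyEq.refl _ _)),
        ← eLpNorm_two_sq volume (fun x => G (a, x) - c x), ← ENNReal.rpow_natCast,
        ← ENNReal.rpow_mul]
      norm_num
      rfl
    · rw [piecewise_eq_of_notMem _ _ _ h, sec,
        dif_neg (show ¬ MemLp (g' a) 2 volume from h), dist_zero_left]
  rw [heq]
  refine Measurable.piecewise hset ?_ measurable_const
  refine (Measurable.pow_const ?_ _).ennreal_toReal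
  exact Measurable.lintegral_prod_right' (f := fun p : α × ℝ => ‖G (p.1, p.2) - c p.2‖ₑ ^ 2)
    (by fun_prop)

lemma memLp_sec [SFinite μ] {g : α → ℝ → ℝ}
    (hg : MemLp (Function.uncurry g) 2 (μ.prod volume)) : MemLp (sec g) 2 μ := by
  refine ⟨aestronglyMeasurable_sec hg, ?_⟩
  have h : eLpNorm (sec g) 2 μ ^ 2 < ⊤ := by
    rw [eLpNorm_two_sq]
    have : ∫⁻ a, ‖sec g a‖ₑ ^ 2 ∂μ = ∫⁻ a, eLpNorm (g a) 2 volume ^ 2 ∂μ := by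
      refine lintegral_congr_ae ?_
      filter_upwards [ae_memLp_sec hg] with a ha
      rw [enorm_sec ha]
    rw [this, lintegral_eLpNorm_sq hg.1]
    exact ENNReal.pow_lt_top hg.2
  simpa using h

end Sec

/-! ### Weak convergence against vector valued functions -/

section Pairing
variable {α E : Type*} [MeasurableSpace α] {μ : Measure α} [NormedAddCommGroup E]
  [NormedSpace ℝ E]

/-- The integral of the product of a scalar and a vector valued square integrable function. -/
def pairing (h : α → ℝ) (G : α → E) (μ : Measure α) : E := ∫ p, h p • G p ∂μ

lemma integrable_pairing {h : α → ℝ} {G : α → E} (hh : MemLp h 2 μ) (hG : MemLp G 2 μ) :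
    Integrable (fun p => h p • G p) μ :=
  memLp_one_iff_integrable.1 (hG.smul hh)

lemma norm_pairing_le (h : Lp ℝ 2 μ) (G : Lp E 2 μ) : ‖pairing h G μ‖ ≤ ‖h‖ * ‖G‖ := by
  have h1 : ‖pairing h G μ‖ₑ ≤ ‖h‖ₑ * ‖G‖ₑ := by
    refine (enorm_integral_le_lintegral_enorm _).trans ?_
    rw [← eLpNorm_one_eq_lintegral_enorm, Lp.enorm_def, Lp.enorm_def]
    exact eLpNorm_smul_le_mul_eLpNorm (Lp.aestronglyMeasurable G) (Lp.aestronglyMeasurable h)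
  rw [← ofReal_norm, ← ofReal_norm, ← ofReal_norm, ← ENNReal.ofReal_mul (norm_nonneg _)] at h1
  exact (ENNReal.ofReal_le_ofReal_iff (by positivity)).1 h1

lemma pairing_congr {h h' : α → ℝ} {G G' : α → E} (e : h =ᵐ[μ] h') (e' : G =ᵐ[μ] G') :
    pairing h G μ = pairing h' G' μ := by
  refine integral_congr_ae ?_
  filter_upwards [e, e'] with p h1 h2
  rw [h1, h2]

lemma pairing_sub_left (h h' : Lp ℝ 2 μ) (G : Lp E 2 μ) :
    pairing (h - h' : Lp ℝ 2 μ) G μ = pairing h G μ - pairing h' G μ := by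
  rw [pairing, pairing, pairing, ← integral_sub (integrable_pairing (Lp.memLp h) (Lp.memLp G))
    (integrable_pairing (Lp.memLp h') (Lp.memLp G))]
  refine integral_congr_ae ?_
  filter_upwards [Lp.coeFn_sub h h'] with p hp
  rw [hp, Pi.sub_apply, sub_smul]

lemma pairing_add_right (h : Lp ℝ 2 μ) (G G' : Lp E 2 μ) :
    pairing h (G + G' : Lp E 2 μ) μ = pairing h G μ + pairing h G' μ := by
  rw [pairing, pairing, pairing, ← integral_add (integrable_pairing (Lp.memLp h) (Lp.memLp G))
    (integrable_pairing (Lp.memLp h) (Lp.memLp G'))]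
  refine integral_congr_ae ?_
  filter_upwards [Lp.coeFn_add G G'] with p hp
  rw [hp, Pi.add_apply, smul_add]

lemma pairing_sub_right (h : Lp ℝ 2 μ) (G G' : Lp E 2 μ) :
    pairing h (G - G' : Lp E 2 μ) μ = pairing h G μ - pairing h G' μ := by
  rw [eq_sub_iff_add_eq, ← pairing_add_right, sub_add_cancel]

variable {ι : Type*} {l : Filter ι} {k : ι → Lp ℝ 2 μ} {R : ℝ} [CompleteSpace E]

/-- A bounded weakly null family is null when paired with a vector valued function. -/
lemma tendsto_pairing (hR : ∀ i, ‖k i‖ ≤ R)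
    (hk : ∀ φ : Lp ℝ 2 μ, Tendsto (fun i => inner ℝ φ (k i)) l (𝓝 0)) (G : Lp E 2 μ) :
    Tendsto (fun i => pairing (k i) G μ) l (𝓝 0) := by
  -- On an indicator times a vector, the pairing is a scalar inner product times that vector, so
  -- weak nullity applies directly. Sums are immediate, and the norm bound on `k` carries the
  -- property to limits.
  induction G using Lp.induction (ENNReal.ofNat_ne_top (n := 2)) with
  | @indicatorConst c s hs hμs =>
    have h1 := (hk (indicatorConstLp 2 hs hμs.ne 1)).smul_const c
    rw [zero_smul] at h1
    refine h1.congr fun i => ?_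
    rw [L2.inner_indicatorConstLp_one hs hμs.ne, ← integral_smul_const, pairing,
      ← integral_indicator hs]
    refine integral_congr_ae ?_
    rw [Lp.simpleFunc.coe_indicatorConst]
    filter_upwards [indicatorConstLp_coeFn (p := 2) (hs := hs) (hμs := hμs.ne) (c := c)] with p hp
    rw [hp]
    by_cases h : p ∈ s <;> simp [h]
  | add hf hg _ h1 h2 =>
    have := h1.add h2
    simp only [add_zero] at this
    exact this.congr fun i => (pairing_add_right _ _ _).symm
  | isClosed =>
    rw [← closure_subset_iff_isClosed]
    intro G hG
    rw [mem_ofPred_eq, Metric.tendsto_nhds]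
    intro ε hε
    have hR1 : 0 < |R| + 1 := by positivity
    obtain ⟨G', hG', hd⟩ := Metric.mem_closure_iff.1 hG (ε / (2 * (|R| + 1))) (by positivity)
    have h1 := Metric.tendsto_nhds.1 (show Tendsto (fun i => pairing (k i) G' μ) l (𝓝 0) from hG')
      (ε / 2) (by positivity)
    filter_upwards [h1] with i hi
    rw [dist_zero_right] at hi ⊢
    have h2 : pairing (k i) G μ = pairing (k i) G' μ + pairing (k i) (G - G' : Lp E 2 μ) μ := by
      rw [pairing_sub_right]; abel
    have h3 := norm_pairing_le (k i) (G - G')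
    rw [← dist_eq_norm] at h3
    have h4 : ‖k i‖ * dist G G' ≤ (|R| + 1) * (ε / (2 * (|R| + 1))) :=
      mul_le_mul ((hR i).trans ((le_abs_self R).trans (by linarith))) hd.le dist_nonneg hR1.le
    have h5 : (|R| + 1) * (ε / (2 * (|R| + 1))) = ε / 2 := by field_simp
    rw [h2]
    linarith [norm_add_le (pairing (k i) G' μ) (pairing (k i) (G - G' : Lp E 2 μ) μ)]

/-- The convergence in `tendsto_pairing` is uniform over compact sets. -/
lemma eventually_pairing_lt (hR : ∀ i, ‖k i‖ ≤ R)
    (hk : ∀ φ : Lp ℝ 2 μ, Tendsto (fun i => inner ℝ φ (k i)) l (𝓝 0)) {K : Set (Lp E 2 μ)}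
    (hK : IsCompact K) {ε : ℝ} (hε : 0 < ε) :
    ∀ᶠ i in l, ∀ G ∈ K, ‖pairing (k i) G μ‖ ≤ ε := by
  have hR1 : 0 < |R| + 1 := by positivity
  -- A finite net reduces to finitely many kernels; the bound on `k` controls the error of passing
  -- to the nearest one.
  obtain ⟨t, -, htf, hcov⟩ := hK.finite_cover_balls (e := ε / (2 * (|R| + 1))) (by positivity)
  have h1 : ∀ᶠ i in l, ∀ G' ∈ t, ‖pairing (k i) G' μ‖ < ε / 2 := by
    rw [htf.eventually_all]
    intro G' _
    have := Metric.tendsto_nhds.1 (tendsto_pairing hR hk G') (ε / 2) (by positivity)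
    simpa using this
  filter_upwards [h1] with i hi G hG
  obtain ⟨G', hG', hd⟩ := mem_iUnion₂.1 (hcov hG)
  have h2 : pairing (k i) G μ = pairing (k i) G' μ + pairing (k i) (G - G' : Lp E 2 μ) μ := by
    rw [pairing_sub_right]; abel
  have h3 := norm_pairing_le (k i) (G - G')
  rw [← dist_eq_norm] at h3
  have h4 : ‖k i‖ * dist G G' ≤ (|R| + 1) * (ε / (2 * (|R| + 1))) :=
    mul_le_mul ((hR i).trans ((le_abs_self R).trans (by linarith))) (Metric.mem_ball.1 hd).le
      dist_nonneg hR1.le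
  have h5 : (|R| + 1) * (ε / (2 * (|R| + 1))) = ε / 2 := by field_simp
  have h6 := hi G' hG'
  rw [h2]
  linarith [norm_add_le (pairing (k i) G' μ) (pairing (k i) (G - G' : Lp E 2 μ) μ)]

end Pairing

/-! ### The stochastic convolution -/

/-- The reference measure for controls on `[0,T] × ℝ`. -/
abbrev ctrlMeasure (T : ℝ) : Measure (ℝ × ℝ) := (volume.restrict (Icc 0 T)).prod volume

section Noise
variable {D : ℝ} {Φ : ℝ → ℝ → ℝ}

/-- The columns `Φ(·, x')` of a kernel as elements of `L²(ℝ)`. -/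
def col (Φ : ℝ → ℝ → ℝ) : ℝ → L2R := sec fun x' x => Φ x x'

lemma memLp_swap {g : ℝ → ℝ → ℝ} (hg : MemLp (Function.uncurry g) 2 (volume.prod volume)) :
    MemLp (Function.uncurry fun x' x => g x x') 2 (volume.prod volume) :=
  hg.comp_measurePreserving Measure.measurePreserving_swap

lemma IsHilbertSchmidtH1.memLp_col (hΦ : IsHilbertSchmidtH1 Φ) : MemLp (col Φ) 2 volume :=
  memLp_sec (memLp_swap hΦ.1)

lemma IsHilbertSchmidtH1.ae_col_eq (hΦ : IsHilbertSchmidtH1 Φ) :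
    ∀ᵐ x', col Φ x' =ᵐ[volume] fun x => Φ x x' := by
  filter_upwards [ae_memLp_sec (memLp_swap hΦ.1)] with x' h
  exact sec_ae_eq h

/-- The heat flow of the columns is dominated in `H¹` by a square integrable function. -/
lemma IsHilbertSchmidtH1.exists_bound (hΦ : IsHilbertSchmidtH1 Φ) (hD : 0 < D) :
    ∃ b : ℝ → ℝ, MemLp b 2 volume ∧ ∀ᵐ x', ∀ τ, ‖heatOp hD τ (col Φ x')‖ ≤ b x' := by
  obtain ⟨h1, Ψ, h2, h3⟩ := hΦ
  refine ⟨fun x' => (∫ z, ‖gaussK D z‖) * (‖col Φ x'‖ + ‖col Ψ x'‖),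
    (((memLp_sec (memLp_swap h1)).norm.add (memLp_sec (memLp_swap h2)).norm).const_mul _), ?_⟩
  filter_upwards [ae_memLp_sec (memLp_swap h1), ae_memLp_sec (memLp_swap h2), h3] with x' m1 m2 hw τ
  let y : H1 := ⟨(col Φ x', col Ψ x'), hw.congr
    (sec_ae_eq (g := fun x' x => Φ x x') m1).symm (sec_ae_eq (g := fun x' x => Ψ x x') m2).symm⟩
  refine (norm_heatOp_H1_le hD τ y).trans (mul_le_mul_of_nonneg_left ?_
    (integral_nonneg fun _ => norm_nonneg _))
  exact max_le (le_add_of_nonneg_right (norm_nonneg _)) (le_add_of_nonneg_left (norm_nonneg _))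

lemma stronglyMeasurable_heatOp {α : Type*} [MeasurableSpace α] (hD : 0 < D) {r : α → ℝ}
    {g : α → L2R} (hr : Measurable r) (hg : StronglyMeasurable g) :
    StronglyMeasurable fun a => heatOp hD (r a) (g a) := by
  classical
  borelize L2R
  have hs : MeasurableSet {p : ℝ × L2R | 0 < p.1} :=
    measurableSet_lt measurable_const measurable_fst
  have heq : (fun p : ℝ × L2R => heatOp hD p.1 p.2) =
      {p : ℝ × L2R | 0 < p.1}.piecewise (fun p => heatOp hD p.1 p.2) fun _ => 0 := by
    funext p
    by_cases h : p ∈ {p : ℝ × L2R | 0 < p.1}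
    · rw [piecewise_eq_of_mem _ _ _ h]
    · rw [piecewise_eq_of_notMem _ _ _ h]
      exact heatOp_of_nonpos hD (not_lt.1 h) _
  have hm : Measurable fun p : ℝ × L2R => heatOp hD p.1 p.2 := by
    rw [heq]
    refine ContinuousOn.measurable_piecewise (fun p hp => ?_) continuousOn_const hs
    exact (continuousAt_heatOp hD hp p.2).continuousWithinAt
  exact (hm.comp (hr.prodMk hg.measurable)).stronglyMeasurable

/-- The kernel of the stochastic convolution at time `t`. -/
def noiseKernel (hD : 0 < D) (Φ : ℝ → ℝ → ℝ) (t : ℝ) (p : ℝ × ℝ) : H1 :=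
  heatOp hD (t - p.1) (col Φ p.2)

lemma IsHilbertSchmidtH1.aestronglyMeasurable_noiseKernel (hΦ : IsHilbertSchmidtH1 Φ) (hD : 0 < D)
    (T t : ℝ) : AEStronglyMeasurable (noiseKernel hD Φ t) (ctrlMeasure T) := by
  obtain ⟨g, hg, hae⟩ := hΦ.memLp_col.1
  refine ⟨fun p => heatOp hD (t - p.1) (g p.2), ?_, ?_⟩
  · exact stronglyMeasurable_heatOp hD (measurable_const.sub measurable_fst)
      (hg.comp_measurable measurable_snd)
  · have := Measure.quasiMeasurePreserving_snd (μ := volume.restrict (Icc 0 T))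
      (ν := (volume : Measure ℝ)) |>.ae_eq_comp hae
    filter_upwards [this] with p hp
    rw [noiseKernel]
    exact congrArg _ hp

lemma memLp_comp_snd {E : Type*} [NormedAddCommGroup E] (T : ℝ) {b : ℝ → E}
    (hb : MemLp b 2 volume) : MemLp (fun p : ℝ × ℝ => b p.2) 2 (ctrlMeasure T) := by
  have := hb.comp_snd (volume.restrict (Icc 0 T))
  exact this

lemma IsHilbertSchmidtH1.ae_norm_noiseKernel_le (hD : 0 < D) {b : ℝ → ℝ}
    (hb : ∀ᵐ x', ∀ τ, ‖heatOp hD τ (col Φ x')‖ ≤ b x') (T : ℝ) :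
    ∀ᵐ p ∂(ctrlMeasure T), ∀ t, ‖noiseKernel hD Φ t p‖ ≤ b p.2 := by
  have := (Measure.quasiMeasurePreserving_snd (μ := volume.restrict (Icc 0 T))
    (ν := (volume : Measure ℝ))).ae hb
  filter_upwards [this] with p hp t
  exact hp _

lemma IsHilbertSchmidtH1.memLp_noiseKernel (hΦ : IsHilbertSchmidtH1 Φ) (hD : 0 < D) (T t : ℝ) :
    MemLp (noiseKernel hD Φ t) 2 (ctrlMeasure T) := by
  obtain ⟨b, hb, hle⟩ := hΦ.exists_bound hD
  refine (memLp_comp_snd T hb).of_le (hΦ.aestronglyMeasurable_noiseKernel hD T t) ?_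
  filter_upwards [IsHilbertSchmidtH1.ae_norm_noiseKernel_le hD hle T] with p hp
  exact (hp t).trans (le_abs_self _)

/-- The noise kernel as a curve in `L²([0,T] × ℝ; H¹)`. -/
def noiseCurve (hΦ : IsHilbertSchmidtH1 Φ) (hD : 0 < D) (T t : ℝ) : Lp H1 2 (ctrlMeasure T) :=
  (hΦ.memLp_noiseKernel hD T t).toLp _

/-- Dominated convergence over `(s, x')`: the heat flow is continuous in `t` at `t₀` off the null
set `s = t₀`, and twice the time-independent bound of `exists_bound` dominates the difference.
Compactness of the image over `[0,T]` rests on this. -/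
lemma continuous_noiseCurve (hΦ : IsHilbertSchmidtH1 Φ) (hD : 0 < D) (T : ℝ) :
    Continuous (noiseCurve hΦ hD T) := by
  refine continuous_iff_continuousAt.2 fun t₀ => ?_
  obtain ⟨b, hb, hle⟩ := hΦ.exists_bound hD
  have hm := hΦ.aestronglyMeasurable_noiseKernel hD T
  refine (Lp.tendsto_Lp_iff_tendsto_eLpNorm'' _ (hΦ.memLp_noiseKernel hD T) _
    (hΦ.memLp_noiseKernel hD T t₀)).2 ?_
  have key : Tendsto (fun t => ∫⁻ p, ‖noiseKernel hD Φ t p - noiseKernel hD Φ t₀ p‖ₑ ^ 2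
      ∂(ctrlMeasure T)) (𝓝 t₀) (𝓝 (∫⁻ _, 0 ∂(ctrlMeasure T))) := by
    refine tendsto_lintegral_filter_of_dominated_convergence'
      (fun p => ‖(2 : ℝ) * b p.2‖ₑ ^ 2) ?_ ?_ ?_ ?_
    · exact Eventually.of_forall fun t => ((hm t).sub (hm t₀)).enorm.pow_const 2
    · refine Eventually.of_forall fun t => ?_
      filter_upwards [IsHilbertSchmidtH1.ae_norm_noiseKernel_le hD hle T] with p hp
      gcongr
      rw [← ofReal_norm, ← ofReal_norm]
      refine ENNReal.ofReal_le_ofReal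
        (((norm_sub_le _ _).trans (add_le_add (hp t) (hp t₀))).trans ?_)
      rw [← two_mul]
      exact le_abs_self _
    · rw [← eLpNorm_two_sq]
      exact ENNReal.pow_ne_top ((memLp_comp_snd T hb).const_mul 2).2.ne
    · have hne : ∀ᵐ p ∂(ctrlMeasure T), p.1 ≠ t₀ := by
        refine (Measure.quasiMeasurePreserving_fst (μ := volume.restrict (Icc 0 T))
          (ν := (volume : Measure ℝ))).ae (p := fun s => s ≠ t₀) ?_
        exact ae_restrict_of_ae (by simp [ae_iff])
      filter_upwards [hne] with p hp
      have h0 : Tendsto (fun t => noiseKernel hD Φ t p - noiseKernel hD Φ t₀ p) (𝓝 t₀) (𝓝 0) := by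
        rcases lt_or_gt_of_ne hp with h | h
        · have h1 : ContinuousAt (fun t => noiseKernel hD Φ t p) t₀ :=
            ContinuousAt.comp (f := fun t => (t - p.1, col Φ p.2)) (x := t₀)
              (continuousAt_heatOp hD (sub_pos.2 h) (col Φ p.2)) (by fun_prop)
          simpa using h1.tendsto.sub_const (noiseKernel hD Φ t₀ p)
        · refine tendsto_const_nhds.congr' ?_
          filter_upwards [eventually_lt_nhds h] with t ht
          rw [noiseKernel, noiseKernel, heatOp_of_nonpos hD (sub_nonpos.2 ht.le),
            heatOp_of_nonpos hD (sub_nonpos.2 h.le), sub_zero]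
      have h1 : Tendsto (fun t => ‖noiseKernel hD Φ t p - noiseKernel hD Φ t₀ p‖ₑ ^ 2) (𝓝 t₀)
        (𝓝 (‖(0 : H1)‖ₑ ^ 2)) := ((ENNReal.continuous_pow 2).tendsto _).comp h0.enorm
      have e : ‖(0 : H1)‖ₑ ^ 2 = 0 := by rw [← ofReal_norm]; simp
      rwa [e] at h1
  rw [lintegral_zero] at key
  have h2 : Tendsto (fun t => eLpNorm (noiseKernel hD Φ t - noiseKernel hD Φ t₀) 2
      (ctrlMeasure T)) (𝓝 t₀) (𝓝 0) := by
    have := (ENNReal.continuous_rpow_const (y := 1 / 2)).tendsto 0 |>.comp key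
    rw [ENNReal.zero_rpow_of_pos (by norm_num)] at this
    refine this.congr fun t => ?_
    simp only [Function.comp_apply]
    rw [show (∫⁻ p, ‖noiseKernel hD Φ t p - noiseKernel hD Φ t₀ p‖ₑ ^ 2 ∂(ctrlMeasure T)) =
      eLpNorm (noiseKernel hD Φ t - noiseKernel hD Φ t₀) 2 (ctrlMeasure T) ^ 2 from
        (eLpNorm_two_sq _ _).symm, ← ENNReal.rpow_natCast, ← ENNReal.rpow_mul]
    norm_num
  exact h2

lemma memLp_mul_prod {f g : ℝ → ℝ} (hf : MemLp f 2 volume) (hg : MemLp g 2 volume) :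
    MemLp (fun p : ℝ × ℝ => f p.1 * g p.2) 2 (volume.prod volume) := by
  have hm : AEStronglyMeasurable (fun p : ℝ × ℝ => f p.1 * g p.2) (volume.prod volume) :=
    hf.1.comp_fst.mul hg.1.comp_snd
  rw [memLp_two_iff_integrable_sq hm]
  simp only [mul_pow]
  exact hf.integrable_sq.mul_prod hg.integrable_sq

/-- Exchanging the heat flow and the kernel operator. -/
lemma IsHilbertSchmidtH1.heat_kernelOp (hΦ : IsHilbertSchmidtH1 Φ) (hD : 0 < D) {τ : ℝ} (hτ : 0 < τ)
    {f : ℝ → ℝ} (hf : MemLp f 2 volume) (x : ℝ) :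
    heat D τ (kernelOp Φ f) x = ∫ x', f x' * H1.ev x (heatOp hD τ (col Φ x')) := by
  have hk : MemLp (fun y => dil (gaussK D) τ (x - y)) 2 volume :=
    memLp_comp_sub_left ((isRapid_gaussK hD).dil τ).memLp x
  have hint : Integrable (fun p : ℝ × ℝ =>
      (dil (gaussK D) τ (x - p.1) * f p.2) * Φ p.1 p.2) (volume.prod volume) :=
    (memLp_mul_prod hk hf).integrable_mul hΦ.1
  rw [heat_eq_convFn hτ, convFn]
  have e1 : ∀ y, dil (gaussK D) τ (x - y) * kernelOp Φ f y =
      ∫ x', (dil (gaussK D) τ (x - y) * f x') * Φ y x' := fun y => by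
    rw [kernelOp, ← integral_const_mul]
    exact integral_congr_ae (ae_of_all _ fun x' => by ring)
  simp only [e1]
  rw [integral_integral_swap hint]
  refine integral_congr_ae ?_
  filter_upwards [hΦ.ae_col_eq] with x' hx'
  rw [ev_heatOp hD hτ, heat_eq_convFn hτ, convFn_congr hx', convFn, ← integral_const_mul]
  exact integral_congr_ae (ae_of_all _ fun y => by ring)

/-- Point values of the stochastic convolution. -/
lemma IsHilbertSchmidtH1.ev_pairing (hΦ : IsHilbertSchmidtH1 Φ) (hD : 0 < D) {T t : ℝ}
    (ht : t ∈ Icc 0 T) {h : ℝ → ℝ → ℝ} (hh : IsControl T h) (x : ℝ) :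
    H1.ev x (pairing (Function.uncurry h) (noiseKernel hD Φ t) (ctrlMeasure T)) =
      ∫ s in (0 : ℝ)..t, heat D (t - s) (kernelOp Φ (h s)) x := by
  have hi := integrable_pairing hh (hΦ.memLp_noiseKernel hD T t)
  have hi2 := (H1.ev x).integrable_comp hi
  rw [pairing, ← (H1.ev x).integral_comp_comm hi, integral_prod _ hi2,
    intervalIntegral.integral_of_le ht.1]
  have hsub : Ioc 0 t ⊆ Icc 0 T := fun s hs => ⟨hs.1.le, hs.2.trans ht.2⟩
  have hz :
      ∫ s in Icc 0 T, ∫ x', H1.ev x (Function.uncurry h (s, x') • noiseKernel hD Φ t (s, x')) =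
      ∫ s in Ioc 0 t, ∫ x', H1.ev x (Function.uncurry h (s, x') • noiseKernel hD Φ t (s, x')) := by
    refine setIntegral_eq_of_subset_of_ae_sdiff_eq_zero measurableSet_Icc.nullMeasurableSet hsub ?_
    have h0 : ∀ᵐ s : ℝ, s ≠ 0 := by simp [ae_iff]
    filter_upwards [h0] with s hs0 hs
    have hts : t ≤ s := by
      by_contra! hlt
      exact hs.2 ⟨lt_of_le_of_ne hs.1.1 (Ne.symm hs0), hlt.le⟩
    simp [noiseKernel, heatOp_of_nonpos hD (sub_nonpos.2 hts)]
  rw [hz]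
  refine setIntegral_congr_ae measurableSet_Ioc ?_
  have h1 : ∀ᵐ s : ℝ, s ≠ t := by simp [ae_iff]
  have h2 : ∀ᵐ s : ℝ, s ∈ Icc 0 T → MemLp (h s) 2 volume :=
    (ae_restrict_iff' measurableSet_Icc).1 (ae_memLp_sec hh)
  filter_upwards [h1, h2] with s hs1 hs2 hs
  rw [hΦ.heat_kernelOp hD (sub_pos.2 (lt_of_le_of_ne hs.2 hs1)) (hs2 (hsub hs))]
  simp [noiseKernel]

end Noise

/-! ### Compactness of the set of mild solutions -/

/-- Bounded sequences in a Hilbert space have weak limits along ultrafilters. -/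
lemma exists_weak_limit {V ι : Type*} [NormedAddCommGroup V] [InnerProductSpace ℝ V]
    [CompleteSpace V] {R : ℝ} {k : ι → V} (hk : ∀ n, ‖k n‖ ≤ R) (l : Ultrafilter ι) :
    ∃ k₀ : V, ‖k₀‖ ≤ R ∧ ∀ φ : V, Tendsto (fun n => inner ℝ φ (k n - k₀)) l (𝓝 0) := by
  let j : ι → WeakDual ℝ V := fun n => StrongDual.toWeakDual (InnerProductSpace.toDual ℝ V (k n))
  have hj : ∀ n, j n ∈ WeakDual.toStrongDual ⁻¹' Metric.closedBall (0 : StrongDual ℝ V) R :=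
    fun n => by
      have : ‖InnerProductSpace.toDual ℝ V (k n)‖ ≤ R := by simpa using hk n
      exact mem_closedBall_zero_iff.2 this
  -- Banach–Alaoglu in the dual, transported back by the Riesz isomorphism.
  obtain ⟨w, hw, hlim⟩ := (WeakDual.isCompact_closedBall (0 : StrongDual ℝ V) R).ultrafilter_le_nhds
    (l.map j) (le_principal_iff.2 (Ultrafilter.mem_map.2 (Filter.univ_mem' hj)))
  set k₀ := (InnerProductSpace.toDual ℝ V).symm (WeakDual.toStrongDual w) with hk₀
  refine ⟨k₀, ?_, fun φ => ?_⟩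
  · have : ‖WeakDual.toStrongDual w‖ ≤ R := mem_closedBall_zero_iff.1 hw
    simpa [hk₀] using this
  · have h1 : Tendsto j l (𝓝 w) := hlim
    have h2 : Tendsto (fun n => inner ℝ (k n) φ) l (𝓝 (inner ℝ k₀ φ)) := by
      have h3 := ((WeakDual.eval_continuous φ).tendsto w).comp h1
      have e : inner ℝ k₀ φ = w φ := by
        rw [hk₀, InnerProductSpace.toDual_symm_apply]; rfl
      rw [e]
      exact h3
    have h4 := h2.sub_const (inner ℝ k₀ φ)
    rw [sub_self] at h4
    refine h4.congr fun n => ?_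
    rw [← inner_sub_left, real_inner_comm]

section Compactness
variable {D : ℝ} {Φ : ℝ → ℝ → ℝ} {F U : ℝ → ℝ} {C : ℝ}

lemma pairing_noiseCurve (hΦ : IsHilbertSchmidtH1 Φ) (hD : 0 < D) (T t : ℝ)
    (k : Lp ℝ 2 (ctrlMeasure T)) :
    pairing k (noiseCurve hΦ hD T t) (ctrlMeasure T) =
      pairing k (noiseKernel hD Φ t) (ctrlMeasure T) :=
  pairing_congr (EventuallyEq.refl _ _) (hΦ.memLp_noiseKernel hD T t).coeFn_toLp

/-- The left hand side of the abstract mild equation for the curve `v` with control `k`. -/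
def mildDefect (hF : FluxData F U C) (hΦ : IsHilbertSchmidtH1 Φ) (hD : 0 < D) (T : ℝ)
    (k : Lp ℝ 2 (ctrlMeasure T)) (v : ℝ → H1) (t : ℝ) : H1 :=
  v t + duhamel hD (fun s => hF.nonlin (v s)) t -
    pairing k (noiseCurve hΦ hD T t) (ctrlMeasure T)

/-- Two curves with the same mild defect are controlled by the difference of their noise terms. -/
lemma exists_stability_const (hF : FluxData F U C) (hD : 0 < D) {T : ℝ} (hT : 0 ≤ T) (B : ℝ)
    (hB : 0 ≤ B) : ∃ G : ℝ, 0 ≤ G ∧ ∀ (hΦ : IsHilbertSchmidtH1 Φ)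
      (k k' : Lp ℝ 2 (ctrlMeasure T)) (v w : ℝ → H1) (e : ℝ),
      ContinuousOn v (Icc 0 T) → ContinuousOn w (Icc 0 T) → (∀ t ∈ Icc 0 T, ‖w t‖ ≤ B) →
      (∀ t ∈ Icc 0 T, mildDefect hF hΦ hD T k v t = mildDefect hF hΦ hD T k' w t) →
      0 ≤ e →
      (∀ t ∈ Icc 0 T, ‖pairing (k - k' : Lp ℝ 2 (ctrlMeasure T)) (noiseCurve hΦ hD T t)
        (ctrlMeasure T)‖ ≤ e) →
      ∀ t ∈ Icc 0 T, ‖v t - w t‖ ≤ G * e := by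
  obtain ⟨A, hA, hle⟩ := norm_heatOp_le hD T
  -- The Lipschitz constant of the nonlinearity around `w`; no bound on `v` enters, so the estimate
  -- also yields a priori bounds.
  set L := C * (1 + 2 * (‖hF.memLp.toLp (deriv U)‖ + B)) with hL
  have hC := hF.nonneg
  obtain ⟨G, hG, hgr⟩ := singular_gronwall T (A * L) hT (by positivity)
  refine ⟨G, hG, fun hΦ k k' v w e hv hw hwB heq he hke => ?_⟩
  have hd : ContinuousOn (fun s => ‖v s - w s‖) (Icc 0 T) := (hv.sub hw).norm
  refine hgr (fun t => ‖v t - w t‖) e he hd fun t ht => ?_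
  have h1 := norm_duhamel_sub_le hD hle hA ht (hF.continuous_nonlin.comp_continuousOn hw)
    (hF.continuous_nonlin.comp_continuousOn hv) (L := L) hd fun s hs => by
      rw [norm_sub_rev]
      refine (hF.nonlin_sub_le (v s) (w s)).trans
        (mul_le_mul_of_nonneg_right ?_ (norm_nonneg _))
      exact mul_le_mul_of_nonneg_left (by linarith [hwB s hs]) hC
  have h2 : v t - w t = pairing (k - k' : Lp ℝ 2 (ctrlMeasure T)) (noiseCurve hΦ hD T t)
      (ctrlMeasure T) + (duhamel hD (hF.nonlin ∘ w) t - duhamel hD (hF.nonlin ∘ v) t) := by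
    have h3 := heq t ht
    rw [mildDefect, mildDefect] at h3
    rw [pairing_sub_left]
    simp only [Function.comp_def]
    rw [← sub_eq_zero] at h3 ⊢
    rw [← h3]
    abel
  calc ‖v t - w t‖ ≤ _ + _ := h2 ▸ norm_add_le _ _
    _ ≤ _ := add_le_add (hke t ht) h1

/-- Weak compactness of controls yields limits of solutions of the abstract mild equation. -/
lemma exists_limit_solution (hF : FluxData F U C) (hΦ : IsHilbertSchmidtH1 Φ) (hD : 0 < D) {T : ℝ}
    (hT : 0 ≤ T) {R : ℝ} {k : ℕ → Lp ℝ 2 (ctrlMeasure T)} (hk : ∀ n, ‖k n‖ ≤ R) {v : ℕ → ℝ → H1}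
    (hv : ∀ n, ContinuousOn (v n) (Icc 0 T))
    (heq : ∀ n, ∀ t ∈ Icc 0 T, mildDefect hF hΦ hD T (k n) (v n) t =
      mildDefect hF hΦ hD T (k 0) (v 0) t) :
    ∃ (k₀ : Lp ℝ 2 (ctrlMeasure T)) (v₀ : ℝ → H1) (l : Filter ℕ), ‖k₀‖ ≤ R ∧
      ContinuousOn v₀ (Icc 0 T) ∧ l.NeBot ∧ l ≤ atTop ∧
      (∀ t ∈ Icc 0 T, Tendsto (fun n => v n t) l (𝓝 (v₀ t))) ∧
      ∀ t ∈ Icc 0 T, mildDefect hF hΦ hD T k₀ v₀ t = mildDefect hF hΦ hD T (k 0) (v 0) t := by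
  -- An ultrafilter finer than `atTop` replaces the extraction of a weakly convergent subsequence.
  set l : Ultrafilter ℕ := Ultrafilter.of atTop with hl
  obtain ⟨k₀, hk₀, hweak⟩ := exists_weak_limit hk l
  have hC := hF.nonneg
  have hR0 : 0 ≤ R := (norm_nonneg _).trans (hk 0)
  have hcomp : IsCompact (noiseCurve hΦ hD T '' Icc 0 T) :=
    isCompact_Icc.image (continuous_noiseCurve hΦ hD T)
  have hsmall : ∀ ε : ℝ, 0 < ε → ∀ᶠ n in (l : Filter ℕ), ∀ t ∈ Icc 0 T,
      ‖pairing (k n - k₀ : Lp ℝ 2 (ctrlMeasure T)) (noiseCurve hΦ hD T t) (ctrlMeasure T)‖ ≤ ε := by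
    intro ε hε
    have h1 := eventually_pairing_lt (k := fun n => k n - k₀) (R := R + R) (l := l)
      (fun n => (norm_sub_le _ _).trans (add_le_add (hk n) hk₀)) hweak hcomp hε
    filter_upwards [h1] with n hn t ht
    exact hn _ (mem_image_of_mem _ ht)
  obtain ⟨B₀, hB₀⟩ := isCompact_Icc.exists_bound_of_continuousOn (hv 0)
  have hB₀0 : 0 ≤ B₀ := (norm_nonneg _).trans (hB₀ 0 ⟨le_rfl, hT⟩)
  obtain ⟨M, hM⟩ := isCompact_Icc.exists_bound_of_continuousOn
    (continuous_noiseCurve hΦ hD T).continuousOn (s := Icc 0 T)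
  have hM0 : 0 ≤ M := (norm_nonneg _).trans (hM 0 ⟨le_rfl, hT⟩)
  -- Stability is used twice. With the fixed reference path `v 0` it bounds all paths uniformly;
  -- with that bound `B` it then compares any two of them.
  obtain ⟨G₀, hG₀, hst₀⟩ := exists_stability_const (Φ := Φ) hF hD hT B₀ hB₀0
  set B := B₀ + G₀ * ((R + R) * M) with hBdef
  have hB : ∀ n, ∀ t ∈ Icc 0 T, ‖v n t‖ ≤ B := by
    intro n t ht
    have h1 := hst₀ hΦ (k n) (k 0) (v n) (v 0) ((R + R) * M) (hv n) (hv 0) hB₀ (heq n)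
      (by positivity) (fun t ht => (norm_pairing_le _ _).trans
        (mul_le_mul ((norm_sub_le _ _).trans (add_le_add (hk n) (hk 0))) (hM t ht)
          (norm_nonneg _) (by positivity))) t ht
    have h2 := norm_add_le (v 0 t) (v n t - v 0 t)
    rw [add_sub_cancel] at h2
    linarith [hB₀ t ht]
  have hB0 : 0 ≤ B := by positivity
  obtain ⟨G, hG, hst⟩ := exists_stability_const (Φ := Φ) hF hD hT B hB0
  have hcauchy : UniformCauchySeqOn v (l : Filter ℕ) (Icc 0 T) := by
    intro V hV
    obtain ⟨ε, hε, hεV⟩ := Metric.mem_uniformity_dist.1 hV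
    have hδ : 0 < ε / (4 * (G + 1)) := by positivity
    have h1 := hsmall _ hδ
    filter_upwards [h1.prod_mk h1] with p hp t ht
    refine hεV ?_
    rw [dist_eq_norm]
    refine (hst hΦ (k p.1) (k p.2) (v p.1) (v p.2) (2 * (ε / (4 * (G + 1)))) (hv _) (hv _)
      (hB _) (fun t ht => (heq _ t ht).trans (heq _ t ht).symm) (by positivity)
      (fun t ht => ?_) t ht).trans_lt ?_
    · have e : k p.1 - k p.2 = (k p.1 - k₀) - (k p.2 - k₀) := by abel
      rw [e, pairing_sub_left, two_mul]
      exact (norm_sub_le _ _).trans (add_le_add (hp.1 t ht) (hp.2 t ht))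
    · have : G * (2 * (ε / (4 * (G + 1)))) = ε / 2 * (G / (G + 1)) := by field_simp; norm_num
      rw [this]
      have h3 : G / (G + 1) ≤ 1 := (div_le_one (by positivity)).2 (by linarith)
      nlinarith
  have hpt : ∀ t, ∃ y : H1, t ∈ Icc 0 T → Tendsto (fun n => v n t) l (𝓝 y) := by
    intro t
    by_cases ht : t ∈ Icc 0 T
    · obtain ⟨y, hy⟩ := CompleteSpace.complete (hcauchy.cauchy_map ht)
      exact ⟨y, fun _ => hy⟩
    · exact ⟨0, fun h => absurd h ht⟩
  choose v₀ hv₀ using hpt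
  have hunif : TendstoUniformlyOn v v₀ (l : Filter ℕ) (Icc 0 T) :=
    hcauchy.tendstoUniformlyOn_of_tendsto fun t ht => hv₀ t ht
  have hv₀c : ContinuousOn v₀ (Icc 0 T) :=
    hunif.continuousOn (Eventually.of_forall hv).frequently
  have hv₀B : ∀ t ∈ Icc 0 T, ‖v₀ t‖ ≤ B := fun t ht =>
    le_of_tendsto (hv₀ t ht).norm (Eventually.of_forall fun n => hB n t ht)
  refine ⟨k₀, v₀, l, hk₀, hv₀c, inferInstance, Ultrafilter.of_le _, hv₀, fun t ht => ?_⟩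
  obtain ⟨A, hA, hle⟩ := norm_heatOp_le hD T
  set L := C * (1 + 2 * (‖hF.memLp.toLp (deriv U)‖ + B)) with hL
  have hL0 : 0 ≤ L := by positivity
  set I := ∫ s in (0 : ℝ)..t, (Real.sqrt (t - s))⁻¹ with hI
  have hI0 : 0 ≤ I := intervalIntegral.integral_nonneg ht.1 fun s _ =>
    inv_nonneg.2 (Real.sqrt_nonneg _)
  have hduh : Tendsto (fun n => duhamel hD (fun s => hF.nonlin (v n s)) t) l
      (𝓝 (duhamel hD (fun s => hF.nonlin (v₀ s)) t)) := by
    rw [Metric.tendsto_nhds]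
    intro ε hε
    have hη : 0 < ε / (2 * (A * L * I + 1)) := by positivity
    filter_upwards [Metric.tendstoUniformlyOn_iff.1 hunif _ hη] with n hn
    rw [dist_eq_norm]
    have h1 := norm_duhamel_sub_le hD hle hA ht (hF.continuous_nonlin.comp_continuousOn (hv n))
      (hF.continuous_nonlin.comp_continuousOn hv₀c) (L := L)
      (d := fun _ => ε / (2 * (A * L * I + 1))) continuousOn_const fun s hs => by
        refine (hF.nonlin_sub_le (v n s) (v₀ s)).trans ?_
        refine mul_le_mul (mul_le_mul_of_nonneg_left (by linarith [hv₀B s hs]) hC) ?_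
          (norm_nonneg _) hL0
        have := hn s hs
        rw [dist_comm, dist_eq_norm] at this
        exact this.le
    rw [intervalIntegral.integral_mul_const] at h1
    refine h1.trans_lt ?_
    rw [← mul_assoc, mul_div_assoc', div_lt_iff₀ (by positivity)]
    nlinarith [mul_nonneg (mul_nonneg hA hL0) hI0]
  have hpair : Tendsto (fun n => pairing (k n) (noiseCurve hΦ hD T t) (ctrlMeasure T)) l
      (𝓝 (pairing k₀ (noiseCurve hΦ hD T t) (ctrlMeasure T))) := by
    rw [tendsto_iff_norm_sub_tendsto_zero, Metric.tendsto_nhds]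
    intro ε hε
    filter_upwards [hsmall (ε / 2) (by positivity)] with n hn
    rw [dist_zero_right, norm_norm, ← pairing_sub_left]
    linarith [hn t ht]
  have hlim : Tendsto (fun n => mildDefect hF hΦ hD T (k n) (v n) t) l
      (𝓝 (mildDefect hF hΦ hD T k₀ v₀ t)) := ((hv₀ t ht).add hduh).sub hpair
  refine tendsto_nhds_unique hlim ?_
  simp only [fun n => heq n t ht]
  exact tendsto_const_nhds

end Compactness

/-! ### Paths as curves in `H¹(ℝ)` -/

section Paths
variable {D T C : ℝ} {Φ : ℝ → ℝ → ℝ} {F U : ℝ → ℝ}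

lemma exists_curve {u : ℝ → ℝ → ℝ} (hu : u ∈ pathSpace T U) :
    ∃ v : ℝ → H1, ContinuousOn v (Icc 0 T) ∧
      ∀ t ∈ Icc 0 T, (fun x => u t x - U x) =ᵐ[volume] (v t).1.1 := by
  obtain ⟨h1, h2⟩ := hu
  have hex : ∀ t, ∃ y : H1, t ∈ Icc 0 T → (fun x => u t x - U x) =ᵐ[volume] y.1.1 := by
    intro t
    by_cases ht : t ∈ Icc 0 T
    · obtain ⟨hf, g, hw, hg⟩ := h1 t ht
      exact ⟨H1.mk _ g hf hg hw, fun _ => hf.coeFn_toLp.symm⟩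
    · exact ⟨0, fun h => absurd h ht⟩
  choose v hv using hex
  refine ⟨v, fun t ht => ?_, hv⟩
  rw [ContinuousWithinAt, tendsto_iff_norm_sub_tendsto_zero]
  have h3 : Tendsto (fun s => ENNReal.ofReal ‖v s - v t‖) (𝓝[Icc 0 T] t) (𝓝 0) := by
    refine tendsto_of_tendsto_of_tendsto_of_le_of_le' tendsto_const_nhds (h2 t ht)
      (Eventually.of_forall fun _ => zero_le) ?_
    filter_upwards [self_mem_nhdsWithin] with s hs
    refine (v s - v t).ofReal_norm_le_eH1norm ?_
    refine EventuallyEq.trans ?_ (Lp.coeFn_sub (v s).1.1 (v t).1.1).symm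
    filter_upwards [hv s hs, hv t ht] with x hx1 hx2
    rw [Pi.sub_apply, ← hx1, ← hx2]
    ring
  have h4 := (ENNReal.tendsto_toReal ENNReal.zero_ne_top).comp h3
  simpa [Function.comp_def] using h4

lemma path_mem_pathSpace {v : ℝ → H1} (hv : ContinuousOn v (Icc 0 T)) :
    (fun t x => U x + H1.ev x (v t)) ∈ pathSpace T U := by
  refine ⟨fun t _ => ?_, fun t ht => ?_⟩
  · have e : (v t).1.1 =ᵐ[volume] fun x => U x + H1.ev x (v t) - U x := by
      filter_upwards [(v t).ae_eq_ev] with x hx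
      rw [hx]; ring
    exact ⟨(memLp_congr_ae e).1 (Lp.memLp _), (v t).1.2,
      (v t).hasWeakDeriv.congr e (EventuallyEq.refl _ _), Lp.memLp _⟩
  · have h1 : Tendsto (fun s => ENNReal.ofReal (2 * ‖v s - v t‖)) (𝓝[Icc 0 T] t) (𝓝 0) := by
      have h2 := (tendsto_iff_norm_sub_tendsto_zero.1 (hv t ht)).const_mul 2
      have h3 := ENNReal.tendsto_ofReal h2
      simpa using h3
    refine tendsto_of_tendsto_of_tendsto_of_le_of_le tendsto_const_nhds h1
      (fun _ => zero_le) fun s => ?_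
    refine (v s - v t).eH1norm_le ?_
    filter_upwards [(v s - v t).ae_eq_ev] with x hx
    rw [hx, map_sub]; ring

/-- The mild equation in terms of the curve of deviations from the profile. -/
lemma isMildSolution_iff (hF : FluxData F U C) (hΦ : IsHilbertSchmidtH1 Φ) (hD : 0 < D)
    {h u : ℝ → ℝ → ℝ} (hh : IsControl T h) (hu : u ∈ pathSpace T U) {v : ℝ → H1}
    (hv : ContinuousOn v (Icc 0 T))
    (huv : ∀ t ∈ Icc 0 T, (fun x => u t x - U x) =ᵐ[volume] (v t).1.1) :
    IsMildSolution F D T U Φ h u ↔ ∀ t ∈ Icc 0 T,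
      (fun x => heat D t U x - U x) =ᵐ[volume] (mildDefect hF hΦ hD T (hh.toLp _) v t).1.1 := by
  have hN : ContinuousOn (fun s => hF.nonlin (v s)) (Icc 0 T) :=
    hF.continuous_nonlin.comp_continuousOn hv
  have key : ∀ t ∈ Icc 0 T, ∀ x, H1.ev x (mildDefect hF hΦ hD T (hh.toLp _) v t) =
      H1.ev x (v t) +
        (∫ s in (0 : ℝ)..t, heat D (t - s) (weakDeriv (fun y => F (u s y))) x)
        - ∫ s in (0 : ℝ)..t, heat D (t - s) (kernelOp Φ (h s)) x := by
    intro t ht x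
    rw [mildDefect, map_sub, map_add, ev_duhamel hD ht hN, pairing_noiseCurve,
      pairing_congr hh.coeFn_toLp (EventuallyEq.refl _ _), hΦ.ev_pairing hD ht hh]
    congr 2
    refine intervalIntegral.integral_congr_ae ?_
    have : ∀ᵐ s : ℝ, s ≠ t := by simp [ae_iff]
    filter_upwards [this] with s hst hs
    rw [uIoc_of_le ht.1] at hs
    rw [heat_eq_convFn (sub_pos.2 (lt_of_le_of_ne hs.2 hst)),
      heat_eq_convFn (sub_pos.2 (lt_of_le_of_ne hs.2 hst)),
      convFn_congr (hF.weakDeriv_ae_eq (v s) (huv s ⟨hs.1.le, hs.2.trans ht.2⟩))]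
  have hiff : ∀ t ∈ Icc 0 T, ((∀ᵐ x, u t x = heat D t U x
        - (∫ s in (0 : ℝ)..t, heat D (t - s) (weakDeriv (fun y => F (u s y))) x)
        + ∫ s in (0 : ℝ)..t, heat D (t - s) (kernelOp Φ (h s)) x) ↔
      (fun x => heat D t U x - U x) =ᵐ[volume]
        (mildDefect hF hΦ hD T (hh.toLp _) v t).1.1) := by
    intro t ht
    refine eventually_congr ?_
    filter_upwards [huv t ht, (v t).ae_eq_ev,
      (mildDefect hF hΦ hD T (hh.toLp _) v t).ae_eq_ev] with x h1 h2 h3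
    rw [h3, key t ht x, ← h2, ← h1]
    constructor <;> intro h <;> linarith
  exact ⟨fun hm t ht => (hiff t ht).1 (hm.2 t ht),
    fun hm => ⟨hu, fun t ht => (hiff t ht).2 (hm t ht)⟩⟩

/-- By Tonelli the cost is half the squared norm in `L²([0,T] × ℝ)`, so a norm bound on the weak
limit is a cost bound. -/
lemma controlCost_eq {h : ℝ → ℝ → ℝ} (hh : IsControl T h) :
    controlCost T h = (1 / 2) * ENNReal.ofReal (‖hh.toLp (Function.uncurry h)‖ ^ 2) := by
  have e : ‖hh.toLp (Function.uncurry h)‖ =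
      (eLpNorm (Function.uncurry h) 2 (ctrlMeasure T)).toReal := Lp.norm_toLp _ hh
  rw [controlCost, lintegral_eLpNorm_sq hh.1, e, ENNReal.ofReal_pow ENNReal.toReal_nonneg,
    ENNReal.ofReal_toReal hh.2.ne]

end Paths

/-! ### The rare event -/

section Main
variable {D T C γ x₀ : ℝ} {Φ : ℝ → ℝ → ℝ} {F U : ℝ → ℝ}

lemma displacementEventNhd_mono {δ δ' : ℝ} (h : δ ≤ δ') :
    displacementEventNhd γ T x₀ U δ ⊆ displacementEventNhd γ T x₀ U δ' := fun _ hu =>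
  ⟨hu.1, hu.2.1, hu.2.2.trans (ENNReal.ofReal_le_ofReal h)⟩

lemma displacementEvent_subset (δ : ℝ) :
    displacementEvent γ T x₀ U ⊆ displacementEventNhd γ T x₀ U δ := fun u hu => by
  refine ⟨hu.1, hu.2.1, ?_⟩
  have h1 : (fun x => u T x - U (x - γ * T - x₀)) =ᵐ[volume] (0 : H1).1.1 := by
    refine EventuallyEq.trans ?_ (Lp.coeFn_zero ℝ 2 volume).symm
    filter_upwards [hu.2.2] with x hx
    simp [hx]
  refine ((0 : H1).eH1norm_le h1).trans ?_
  simp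

lemma rateInf_anti {A B : Set (ℝ → ℝ → ℝ)} (h : A ⊆ B) :
    rateInf F D T U Φ B ≤ rateInf F D T U Φ A := biInf_mono h

lemma exists_of_rateInf_lt {A : Set (ℝ → ℝ → ℝ)} {R : ℝ≥0∞} (h : rateInf F D T U Φ A < R) :
    ∃ u ∈ A, ∃ k, IsControl T k ∧ IsMildSolution F D T U Φ k u ∧ controlCost T k < R := by
  simp only [rateInf, rate, iInf_lt_iff] at h
  obtain ⟨u, hu, k, hk, hlt⟩ := h
  exact ⟨u, hu, k, hk.1, hk.2, hlt⟩

lemma rateInf_le_of_mem {A : Set (ℝ → ℝ → ℝ)} {u k : ℝ → ℝ → ℝ} (hu : u ∈ A)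
    (hk : IsControl T k) (hm : IsMildSolution F D T U Φ k u) :
    rateInf F D T U Φ A ≤ controlCost T k :=
  (iInf₂_le u hu).trans (iInf₂_le k ⟨hk, hm⟩)

/-- If the enlarged events can all be reached with cost below `R`, then so can the event. -/
lemma rateInf_displacementEvent_le (hF : FluxData F U C) (hΦ : IsHilbertSchmidtH1 Φ) (hD : 0 < D)
    (hT : 0 ≤ T) {R : ℝ≥0∞} (hR : R ≠ ⊤)
    (h : ∀ δ : ℝ, 0 < δ → rateInf F D T U Φ (displacementEventNhd γ T x₀ U δ) < R) :
    rateInf F D T U Φ (displacementEvent γ T x₀ U) ≤ R := by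
  have hδ : ∀ n : ℕ, (0 : ℝ) < 1 / (n + 1) := fun n => by positivity
  choose u hu k hk hmild hcost using fun n : ℕ => exists_of_rateInf_lt (h _ (hδ n))
  choose v hv huv using fun n => exists_curve (hu n).1
  -- The radius at which half the squared norm equals `R`.
  set r := Real.sqrt (2 * R.toReal) with hr
  have hnorm : ∀ n, ‖(hk n).toLp (Function.uncurry (k n))‖ ≤ r := by
    intro n
    have h1 := (hcost n).le
    rw [controlCost_eq (hk n)] at h1
    have h2 := ENNReal.toReal_mono hR h1
    rw [ENNReal.toReal_mul, ENNReal.toReal_ofReal (by positivity)] at h2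
    refine Real.le_sqrt_of_sq_le ?_
    norm_num at h2 ⊢
    linarith
  have hdef : ∀ n, ∀ t ∈ Icc 0 T, (fun x => heat D t U x - U x) =ᵐ[volume]
      (mildDefect hF hΦ hD T ((hk n).toLp _) (v n) t).1.1 := fun n =>
    (isMildSolution_iff hF hΦ hD (hk n) (hu n).1 (hv n) (huv n)).1 (hmild n)
  have h0T : (0 : ℝ) ∈ Icc 0 T := ⟨le_rfl, hT⟩
  have hTT : T ∈ Icc 0 T := ⟨hT, le_rfl⟩
  -- All defects represent the same function `S(t)U - U`, hence coincide in `H1`; the limit inherits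
  -- that common value and so solves the original equation.
  obtain ⟨k₀, v₀, l, hk₀, hv₀, hl, hle, hlim, hdef₀⟩ := exists_limit_solution hF hΦ hD hT hnorm hv
    fun n t ht => H1.ext_fst (Lp.ext ((hdef n t ht).symm.trans (hdef 0 t ht)))
  set q : ℝ → ℝ → ℝ := fun t x => k₀ (t, x) with hq
  have hqc : IsControl T q := Lp.memLp k₀
  have hqk : hqc.toLp (Function.uncurry q) = k₀ := Lp.toLp_coeFn k₀ hqc
  set w : ℝ → ℝ → ℝ := fun t x => U x + H1.ev x (v₀ t) with hw
  have hwp : w ∈ pathSpace T U := path_mem_pathSpace hv₀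
  have hwv : ∀ t, (fun x => w t x - U x) =ᵐ[volume] (v₀ t).1.1 := fun t => by
    filter_upwards [(v₀ t).ae_eq_ev] with x hx
    rw [hx]; simp [hw]
  have hwm : IsMildSolution F D T U Φ q w := by
    refine (isMildSolution_iff hF hΦ hD hqc hwp hv₀ fun t _ => hwv t).2 fun t ht => ?_
    rw [hqk, hdef₀ t ht]
    exact hdef 0 t ht
  have hw0 : w 0 =ᵐ[volume] U := by
    have h1 : ∀ n, v n 0 = 0 := fun n => by
      refine H1.ext_fst (Lp.ext ((huv n 0 h0T).symm.trans ?_))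
      refine EventuallyEq.trans ?_ (Lp.coeFn_zero ℝ 2 volume).symm
      filter_upwards [(hu n).2.1] with x hx
      simp [hx]
    have h2 : v₀ 0 = 0 := by
      refine tendsto_nhds_unique (hlim 0 h0T) ?_
      simp only [h1]
      exact tendsto_const_nhds
    refine ae_of_all _ fun x => ?_
    simp [hw, h2]
  have hwT : w T =ᵐ[volume] fun x => U (x - γ * T - x₀) := by
    have hUc : Continuous U := hF.profile.continuous
    have hm2 : ∀ n, AEStronglyMeasurable (fun x => u n T x - U (x - γ * T - x₀)) volume := by
      intro n
      have h1 : AEStronglyMeasurable (fun x => U x + (v n T).1.1 x - U (x - γ * T - x₀)) volume :=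
        (hUc.aestronglyMeasurable.add (Lp.aestronglyMeasurable _)).sub
          (hUc.comp (by fun_prop : Continuous fun x : ℝ => x - γ * T - x₀)).aestronglyMeasurable
      refine h1.congr ?_
      filter_upwards [huv n T hTT] with x hx
      rw [← hx]; ring
    have hsum : ∀ n, (fun x => w T x - U (x - γ * T - x₀)) =ᵐ[volume]
        ((v₀ T - v n T).1.1 : ℝ → ℝ) + fun x => u n T x - U (x - γ * T - x₀) := fun n => by
      filter_upwards [hwv T, huv n T hTT, Lp.coeFn_sub (v₀ T).1.1 (v n T).1.1] with x h1 h2 h3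
      have h4 : (v₀ T - v n T).1.1 x = (v₀ T).1.1 x - (v n T).1.1 x := h3
      rw [Pi.add_apply, h4, ← h1, ← h2]
      ring
    -- The terminal condition is an almost everywhere identity, so the `L²` part of the `H¹`
    -- tolerance is enough.
    have hbound : ∀ n, eLpNorm (fun x => w T x - U (x - γ * T - x₀)) 2 volume ≤
        ENNReal.ofReal ‖v₀ T - v n T‖ + ENNReal.ofReal (1 / (n + 1)) := by
      intro n
      rw [eLpNorm_congr_ae (hsum n)]
      refine (eLpNorm_add_le (Lp.aestronglyMeasurable _) (hm2 n) (by norm_num)).trans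
        (add_le_add ?_ ((eLpNorm_le_eH1norm _).trans (hu n).2.2))
      rw [← Lp.enorm_def, ← ofReal_norm]
      exact ENNReal.ofReal_le_ofReal (v₀ T - v n T).norm_fst_le
    have hlim2 : Tendsto (fun n : ℕ => ENNReal.ofReal ‖v₀ T - v n T‖ +
        ENNReal.ofReal (1 / ((n : ℝ) + 1))) l (𝓝 0) := by
      have h1 : Tendsto (fun n : ℕ => ‖v₀ T - v n T‖) l (𝓝 0) := by
        have := (tendsto_const_nhds (x := v₀ T)).sub (hlim T hTT)
        rw [sub_self] at this
        simpa using this.norm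
      have h2 : Tendsto (fun n : ℕ => 1 / ((n : ℝ) + 1)) l (𝓝 0) :=
        tendsto_one_div_add_atTop_nhds_zero_nat.mono_left hle
      have := (ENNReal.tendsto_ofReal h1).add (ENNReal.tendsto_ofReal h2)
      simpa using this
    have hzero : eLpNorm (fun x => w T x - U (x - γ * T - x₀)) 2 volume = 0 :=
      le_antisymm (ge_of_tendsto' hlim2 hbound) zero_le
    rw [eLpNorm_eq_zero_iff ((((Lp.aestronglyMeasurable _).add (hm2 0))).congr (hsum 0).symm)
      (by norm_num)] at hzero
    filter_upwards [hzero] with x hx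
    simpa [sub_eq_zero] using hx
  refine (rateInf_le_of_mem (⟨hwp, hw0, hwT⟩ : w ∈ displacementEvent γ T x₀ U) hqc hwm).trans ?_
  rw [controlCost_eq hqc, hqk]
  have h1 : ‖k₀‖ ^ 2 ≤ 2 * R.toReal := by
    have := pow_le_pow_left₀ (norm_nonneg _) hk₀ 2
    rwa [hr, Real.sq_sqrt (by positivity)] at this
  calc (1 / 2 : ℝ≥0∞) * ENNReal.ofReal (‖k₀‖ ^ 2)
      ≤ (1 / 2) * ENNReal.ofReal (2 * R.toReal) := by gcongr
    _ = R := by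
        rw [ENNReal.ofReal_mul (by norm_num), ENNReal.ofReal_toReal hR, ← mul_assoc, one_div,
          ENNReal.ofReal_ofNat, ENNReal.inv_mul_cancel (by norm_num) (by norm_num), one_mul]

end Main

end

end ShockDisplacement

/-! ### The limit theorem -/

theorem mainTheorem7
    (F : ℝ → ℝ) (hF : ContDiff ℝ 2 F)
    (C_F : ℝ) (hF' : ∀ v, |deriv F v| ≤ C_F) (hF'' : ∀ v, |deriv (deriv F) v| ≤ C_F)
    (D : ℝ) (hD : 0 < D) (T : ℝ) (hT : 0 < T)
    (uL uR : ℝ) (huLR : uL ≠ uR)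
    (U : ℝ → ℝ) (hU : ShockDisplacement.IsWaveProfile F D uL uR U)
    (Φ : ℝ → ℝ → ℝ) (hΦ : ShockDisplacement.IsHilbertSchmidtH1 Φ)
    (γ : ℝ) (hγ : γ = ShockDisplacement.waveSpeed F uL uR) (x₀ : ℝ) :
    AntitoneOn
      (fun δ : ℝ => ShockDisplacement.rateInf F D T U Φ
        (ShockDisplacement.displacementEventNhd γ T x₀ U δ)) (Set.Ioi 0) ∧
    (∀ δ : ℝ, 0 < δ →
      ShockDisplacement.rateInf F D T U Φ
          (ShockDisplacement.displacementEventNhd γ T x₀ U δ)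
        ≤ ShockDisplacement.rateInf F D T U Φ
          (ShockDisplacement.displacementEvent γ T x₀ U)) ∧
    Filter.Tendsto
      (fun δ : ℝ => ShockDisplacement.rateInf F D T U Φ
        (ShockDisplacement.displacementEventNhd γ T x₀ U δ))
      (nhdsWithin 0 (Set.Ioi 0))
      (nhds (ShockDisplacement.rateInf F D T U Φ
        (ShockDisplacement.displacementEvent γ T x₀ U))) := by
  have hanti : AntitoneOn
      (fun δ : ℝ => ShockDisplacement.rateInf F D T U Φ
        (ShockDisplacement.displacementEventNhd γ T x₀ U δ)) (Set.Ioi 0) := fun _ _ _ _ h =>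
    ShockDisplacement.rateInf_anti (ShockDisplacement.displacementEventNhd_mono h)
  have hle : ∀ δ : ℝ, ShockDisplacement.rateInf F D T U Φ
          (ShockDisplacement.displacementEventNhd γ T x₀ U δ)
        ≤ ShockDisplacement.rateInf F D T U Φ
          (ShockDisplacement.displacementEvent γ T x₀ U) := fun δ =>
    ShockDisplacement.rateInf_anti (ShockDisplacement.displacementEvent_subset δ)
  have hflux : ShockDisplacement.FluxData F U C_F :=
    ⟨hF, hF', hF'', hU.contDiff.of_le (by norm_num), hU.memLp_deriv hF.continuous⟩
  refine ⟨hanti, fun δ _ => hle δ, tendsto_order.2 ⟨fun a ha => ?_, fun a ha =>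
    Filter.Eventually.of_forall fun δ => (hle δ).trans_lt ha⟩⟩
  -- Being strictly below the cost of the exact event, `R` is finite even when that cost is `∞`.
  -- Both cases are thus treated together: if every enlarged event cost less than `R`, the exact
  -- event would cost at most `R`.
  obtain ⟨R, haR, hRJ⟩ := exists_between ha
  obtain ⟨δ₀, hδ₀, hR⟩ : ∃ δ : ℝ, 0 < δ ∧ R ≤ ShockDisplacement.rateInf F D T U Φ
      (ShockDisplacement.displacementEventNhd γ T x₀ U δ) := by
    by_contra! hcon
    exact absurd (ShockDisplacement.rateInf_displacementEvent_le hflux hΦ hD hT.le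
      (ne_top_of_lt hRJ) hcon) (not_le.2 hRJ)
  filter_upwards [Ioo_mem_nhdsGT hδ₀] with δ hδ
  exact haR.trans_le (hR.trans (hanti hδ.1 hδ₀ hδ.2.le))
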